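/- Let $k,q,m,\ell\ge 0$ be integers with $q\ge 1$, $2\ell\le m$, $k\le q^m$ and $k^2\ne 2q^m$. Let $A$ and $B$ be systems of $m$ qudits of local dimension $q$, i.e. $A\cong B\cong(\mathbb C^q)^{\otimes m}$, and let $A^kB^k=A_1\cdots A_kB_1\cdots B_k$ denote $k$ copies of each. For $X\in\{A,B,AB\}$ let $$\mathcal T_X(\cdot)=\int_{\mathcal U(X)} U^{\otimes k}\,(\cdot)\,(U^\dagger)^{\otimes k}\,dU$$ be the $k$-fold twirl with respect to the Haar probability measure on the unitary group of $X$. Let $\mathbb F_{A_i^\ell B_i^\ell}$ be the operator that swaps the first $\ell$ qudits of $A_i$ with the first $\ell$ qudits of $B_i$, and let $\mathrm{SWAP}_\ell(Y)=F\,Y\,F$ with $F=\bigotimes_{i=1}^k\mathbb F_{A_i^\ell B_i^\ell}$. On the space $\mathcal L(A^kB^k)$ of operators with the Hilbert–Schmidt norm $\|Y\|_2=\operatorname{tr}(Y^\dagger Y)^{1/2}$ put $$\mathcal P=\mathcal T_A\otimes\mathcal T_B,\qquad \mathcal Q=\mathrm{SWAP}_\ell\circ\mathcal P\circ\mathrm{SWAP}_\ell,\qquad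 \mathcal R=\mathcal T_{AB},$$ and let the subspace angle of $\operatorname{im}\mathcal P$ and $\operatorname{im}\mathcal Q$ be $$c(\operatorname{im}\mathcal P,\operatorname{im}\mathcal Q):=\|\mathcal Q\mathcal P-\mathcal R\|_{2\to2}=\sup_{Y\ne0}\frac{\|\mathcal Q\mathcal P(Y)-\mathcal R(Y)\|_2}{\|Y\|_2}.$$ Then, with $a=\left(1-\frac{k^2}{2q^m}\right)^{-2}$, $$c(\operatorname{im}\mathcal P,\operatorname{im}\mathcal Q)\le\sqrt{9\,a\,k^2\,q^{-m}+4\,a^2\,(k!)^3\,q^{-2\ell}+2\,a^2\,(k!)^5\,q^{-4\ell}}.$$ -/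

import Mathlib

open Matrix MeasureTheory
open scoped Kronecker TensorProduct

noncomputable section

namespace TwirlSwap

section Haar

variable (n : Type) [Fintype n] [DecidableEq n]

instance compactSpace_unitaryGroup : CompactSpace (unitaryGroup n ℂ) := by
  have hclosed : IsClosed {U : Matrix n n ℂ | U ∈ unitaryGroup n ℂ} := by
    have h : {U : Matrix n n ℂ | U ∈ unitaryGroup n ℂ} = {U | U * star U = 1} := by
      ext U
      exact mem_unitaryGroup_iff
    rw [h]
    exact isClosed_eq (by fun_prop) continuous_const
  have hK : IsCompact (Set.pi Set.univ fun _ : n => Set.pi Set.univ fun _ : n =>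
      Metric.closedBall (0 : ℂ) 1) :=
    isCompact_univ_pi fun _ => isCompact_univ_pi fun _ => isCompact_closedBall 0 1
  have hc : IsCompact {U : Matrix n n ℂ | U ∈ unitaryGroup n ℂ} := by
    refine IsCompact.of_isClosed_subset (X := Matrix n n ℂ) hK hclosed ?_
    intro U hU i _ j _
    simpa using entry_norm_bound_of_unitary hU i j
  exact isCompact_iff_compactSpace.mp hc

instance measurableSpace_unitaryGroup : MeasurableSpace (unitaryGroup n ℂ) := borel _

instance borelSpace_unitaryGroup : BorelSpace (unitaryGroup n ℂ) := ⟨rfl⟩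

/-- The Haar probability measure on the unitary group of `ℂⁿ`. -/
def haarUnitary : Measure (unitaryGroup n ℂ) :=
  Measure.haarMeasure (⊤ : TopologicalSpace.PositiveCompacts (unitaryGroup n ℂ))

instance isHaarMeasure_haarUnitary : (haarUnitary n).IsHaarMeasure := by
  unfold haarUnitary
  infer_instance

instance isProbabilityMeasure_haarUnitary : IsProbabilityMeasure (haarUnitary n) :=
  ⟨by
    have h := Measure.haarMeasure_self
      (K₀ := (⊤ : TopologicalSpace.PositiveCompacts (unitaryGroup n ℂ)))
    simpa [haarUnitary] using h⟩

end Haar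

section Twirl

variable {n : Type} [Fintype n] [DecidableEq n]

/-- The tensor power `U^{⊗k}`, a matrix on `(ℂⁿ)^{⊗k}`, whose standard basis is indexed by
`Fin k → n`. -/
def tensorPow (k : ℕ) (U : Matrix n n ℂ) : Matrix (Fin k → n) (Fin k → n) ℂ :=
  Matrix.of fun x y => ∏ i, U (x i) (y i)

theorem continuous_tensorPow {n : Type} (k : ℕ) :
    Continuous (tensorPow k : Matrix n n ℂ → Matrix (Fin k → n) (Fin k → n) ℂ) := by
  refine continuous_matrix fun x y => ?_
  simp only [tensorPow, Matrix.of_apply]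
  fun_prop

theorem integrable_twirl_entry (k : ℕ) (X : Matrix (Fin k → n) (Fin k → n) ℂ)
    (x y : Fin k → n) :
    Integrable (fun U : unitaryGroup n ℂ =>
      (tensorPow k (U : Matrix n n ℂ) * X * (tensorPow k (U : Matrix n n ℂ))ᴴ) x y)
      (haarUnitary n) := by
  have hc : Continuous fun U : unitaryGroup n ℂ => tensorPow k (U : Matrix n n ℂ) :=
    (continuous_tensorPow k).comp continuous_subtype_val
  have h : Continuous fun U : unitaryGroup n ℂ =>
      (tensorPow k (U : Matrix n n ℂ) * X * (tensorPow k (U : Matrix n n ℂ))ᴴ) x y :=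
    ((hc.matrix_mul continuous_const).matrix_mul hc.matrix_conjTranspose).matrix_elem x y
  exact h.integrable_of_hasCompactSupport (HasCompactSupport.of_compactSpace _)

/-- The `k`-fold twirl `X ↦ ∫ U^{⊗k} X (U^{⊗k})† dU` over the unitary group of `ℂⁿ`. The integral
of the matrix-valued function is taken entrywise. -/
def twirl (n : Type) [Fintype n] [DecidableEq n] (k : ℕ) :
    Matrix (Fin k → n) (Fin k → n) ℂ →ₗ[ℂ] Matrix (Fin k → n) (Fin k → n) ℂ where
  toFun X := Matrix.of fun x y => ∫ U : unitaryGroup n ℂ,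
    (tensorPow k (U : Matrix n n ℂ) * X * (tensorPow k (U : Matrix n n ℂ))ᴴ) x y ∂(haarUnitary n)
  map_add' X Y := by
    ext x y
    simp only [Matrix.of_apply, Matrix.add_apply, Matrix.mul_add, Matrix.add_mul]
    exact integral_add (integrable_twirl_entry k X x y) (integrable_twirl_entry k Y x y)
  map_smul' c X := by
    ext x y
    simp only [Matrix.of_apply, Matrix.smul_apply, Matrix.mul_smul, Matrix.smul_mul,
      RingHom.id_apply, smul_eq_mul]
    exact integral_const_mul _ _

end Twirl

section Tensor

variable {a b : Type} [Fintype a] [DecidableEq a] [Fintype b] [DecidableEq b]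

/-- The identification of `L(ℂᵃ) ⊗ L(ℂᵇ)` with `L(ℂᵃ ⊗ ℂᵇ)` that sends `X ⊗ Y` to the
Kronecker product of `X` and `Y`. -/
def kroneckerEquiv (a b : Type) [Fintype a] [DecidableEq a] [Fintype b] [DecidableEq b] :
    (Matrix a a ℂ ⊗[ℂ] Matrix b b ℂ) ≃ₗ[ℂ] Matrix (a × b) (a × b) ℂ :=
  kroneckerTMulLinearEquiv a a b b ℂ ℂ ℂ ℂ ≪≫ₗ (TensorProduct.lid ℂ ℂ).mapMatrix

theorem kroneckerEquiv_tmul (X : Matrix a a ℂ) (Y : Matrix b b ℂ) :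
    kroneckerEquiv a b (X ⊗ₜ[ℂ] Y) = X ⊗ₖ Y := by
  ext i j
  simp [kroneckerEquiv, kroneckerTMulLinearEquiv_tmul, kroneckerMap_apply]

/-- The tensor product `Φ ⊗ Ψ` of linear maps on `L(ℂᵃ)` and `L(ℂᵇ)`, acting on `L(ℂᵃ ⊗ ℂᵇ)`. -/
def superTensor (Φ : Matrix a a ℂ →ₗ[ℂ] Matrix a a ℂ) (Ψ : Matrix b b ℂ →ₗ[ℂ] Matrix b b ℂ) :
    Matrix (a × b) (a × b) ℂ →ₗ[ℂ] Matrix (a × b) (a × b) ℂ :=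
  (kroneckerEquiv a b).toLinearMap ∘ₗ TensorProduct.map Φ Ψ ∘ₗ
    (kroneckerEquiv a b).symm.toLinearMap

theorem superTensor_kronecker (Φ : Matrix a a ℂ →ₗ[ℂ] Matrix a a ℂ)
    (Ψ : Matrix b b ℂ →ₗ[ℂ] Matrix b b ℂ) (X : Matrix a a ℂ) (Y : Matrix b b ℂ) :
    superTensor Φ Ψ (X ⊗ₖ Y) = Φ X ⊗ₖ Ψ Y := by
  have h : (kroneckerEquiv a b).symm (X ⊗ₖ Y) = X ⊗ₜ[ℂ] Y := by
    rw [LinearEquiv.symm_apply_eq, kroneckerEquiv_tmul]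
  simp [superTensor, h, kroneckerEquiv_tmul]

end Tensor

section Norm

theorem exists_bound_of_finiteDimensional {E : Type} [NormedAddCommGroup E] [NormedSpace ℂ E]
    [FiniteDimensional ℂ E] (Φ : E →ₗ[ℂ] E) : ∃ C : ℝ, ∀ x, ‖Φ x‖ ≤ C * ‖x‖ :=
  ⟨‖LinearMap.toContinuousLinearMap Φ‖, (LinearMap.toContinuousLinearMap Φ).le_opNorm⟩

variable {n : Type} [Fintype n]

/-- The Hilbert–Schmidt (Schatten 2-) norm `‖X‖₂ = tr(X† X)^{1/2}`. -/
def hsNorm (X : Matrix n n ℂ) : ℝ := Real.sqrt (Xᴴ * X).trace.re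

/-- The norm `‖Φ‖_{2→2} = sup_{X ≠ 0} ‖Φ(X)‖₂ / ‖X‖₂` of a linear map on operators. -/
def norm22 (Φ : Matrix n n ℂ →ₗ[ℂ] Matrix n n ℂ) : ℝ :=
  sSup {r : ℝ | ∃ X : Matrix n n ℂ, X ≠ 0 ∧ r = hsNorm (Φ X) / hsNorm X}

attribute [local instance] Matrix.frobeniusNormedAddCommGroup Matrix.frobeniusNormedSpace in
/-- The set whose supremum is `‖Φ‖_{2→2}` is bounded, so the supremum is a genuine one. -/
theorem bddAbove_norm22 (Φ : Matrix n n ℂ →ₗ[ℂ] Matrix n n ℂ) :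
    BddAbove {r : ℝ | ∃ X : Matrix n n ℂ, X ≠ 0 ∧ r = hsNorm (Φ X) / hsNorm X} := by
  have hs : ∀ X : Matrix n n ℂ, hsNorm X = ‖X‖ := by
    intro X
    rw [frobenius_norm_def, hsNorm, Real.sqrt_eq_rpow]
    congr 1
    simp only [Matrix.trace, Matrix.diag_apply, Matrix.mul_apply, Matrix.conjTranspose_apply,
      Complex.re_sum]
    rw [Finset.sum_comm]
    refine Finset.sum_congr rfl fun i _ => Finset.sum_congr rfl fun j _ => ?_
    have h := Complex.normSq_eq_conj_mul_self (z := X i j)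
    rw [← Complex.star_def] at h
    rw [← h, Complex.ofReal_re, Complex.normSq_eq_norm_sq]
    norm_cast
  obtain ⟨C, hC⟩ := exists_bound_of_finiteDimensional Φ
  refine ⟨C, ?_⟩
  rintro r ⟨X, hX, rfl⟩
  rw [hs, hs]
  exact (div_le_iff₀ (norm_pos_iff.mpr hX)).mpr (hC X)

end Norm

/-- The standard basis of one block of `m` qudits of local dimension `q`. -/
abbrev Block (q m : ℕ) : Type := Fin m → Fin q

/-- The standard basis of `A^k B^k = A₁…A_k B₁…B_k`, where `A` and `B` are blocks of `m` qudits
of local dimension `q`. -/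
abbrev Full (k q m : ℕ) : Type := (Fin k → Block q m) × (Fin k → Block q m)

/-- The linear operators on `A^k B^k`. -/
abbrev Op (k q m : ℕ) : Type := Matrix (Full k q m) (Full k q m) ℂ

/-- The regrouping of `A₁B₁…A_kB_k` as `A₁…A_k B₁…B_k`, on operators. -/
def regroup (k q m : ℕ) :
    Matrix (Fin k → Block q m × Block q m) (Fin k → Block q m × Block q m) ℂ ≃ₗ[ℂ] Op k q m :=
  Matrix.reindexLinearEquiv ℂ ℂ
    (Equiv.arrowProdEquivProdArrow (Fin k) (fun _ => Block q m) (fun _ => Block q m))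
    (Equiv.arrowProdEquivProdArrow (Fin k) (fun _ => Block q m) (fun _ => Block q m))

/-- The exchange of the first `ℓ` qudits of `A` with the first `ℓ` qudits of `B`, on basis
labels. -/
def swapFirst {q m : ℕ} (ℓ : ℕ) (v : Block q m × Block q m) : Block q m × Block q m :=
  (fun j => if j.val < ℓ then v.2 j else v.1 j, fun j => if j.val < ℓ then v.1 j else v.2 j)

/-- The operator on `A ⊗ B` that swaps the first `ℓ` qudits of `A` with those of `B`. -/
def swapOp (q m ℓ : ℕ) : Matrix (Block q m × Block q m) (Block q m × Block q m) ℂ :=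
  Matrix.of fun v w => if v = swapFirst ℓ w then 1 else 0

/-- `SWAP_ℓ`: conjugation of operators on `A^k B^k` by the `k`-fold tensor power of `swapOp`. -/
def SWAP (k q m ℓ : ℕ) : Op k q m →ₗ[ℂ] Op k q m :=
  LinearMap.mulLeftRight ℂ
    (regroup k q m (tensorPow k (swapOp q m ℓ)), regroup k q m (tensorPow k (swapOp q m ℓ)))

/-- `P = T_A ⊗ T_B`. -/
def P (k q m : ℕ) : Op k q m →ₗ[ℂ] Op k q m :=
  superTensor (twirl (Block q m) k) (twirl (Block q m) k)

/-- `Q = SWAP_ℓ ∘ P ∘ SWAP_ℓ`. -/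
def Q (k q m ℓ : ℕ) : Op k q m →ₗ[ℂ] Op k q m :=
  SWAP k q m ℓ ∘ₗ P k q m ∘ₗ SWAP k q m ℓ

/-- `R = T_{AB}`, the `k`-fold twirl over the unitary group of `A ⊗ B`. -/
def R (k q m : ℕ) : Op k q m →ₗ[ℂ] Op k q m :=
  (regroup k q m).toLinearMap ∘ₗ twirl (Block q m × Block q m) k ∘ₗ
    (regroup k q m).symm.toLinearMap

/-- The subspace angle `c(im P, im Q) = ‖Q P - R‖_{2→2}`. -/
def subspaceAngle (k q m ℓ : ℕ) : ℝ := norm22 (Q k q m ℓ ∘ₗ P k q m - R k q m)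

end TwirlSwap

end

/-! By Schur–Weyl duality the image of `P` is spanned by the tensor products of a permutation of the
`k` copies of `A` with one of the `k` copies of `B`, and the image of `Q` by the conjugates of these
operators under the swap. An inner product of two such operators counts the basis labels on which
they agree; it factors over the `m` qudit positions, and a position contributes a relative factor
`1 / q` for each component in which the two pairs of permutations differ there. Hence each spanning
family is almost orthogonal. A pair of equal permutations commutes with all `U ⊗ ... ⊗ U`, so it is
fixed by the swap and lies in the image of `R`, which `P - R` annihilates. A pair of distinct
permutations differs, before or after the swap, from any other pair often enough that its overlap is
at most `q ^ (-2 * ℓ)` after normalisation. As there are `(k !) ^ 2` pairs, the subspace angle is at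
most `2 * (k !) ^ 2 / q ^ (2 * ℓ)`; it is also at most `1`. -/

noncomputable section

namespace TwirlSwap

open scoped InnerProductSpace

section AlmostOrthogonal

variable {𝕜 E ι : Type*} [RCLike 𝕜] [NormedAddCommGroup E] [InnerProductSpace 𝕜 E] [Fintype ι]

/-- A family of vectors of squared norm `s` whose mutual inner products are at most `t` in modulus.
The vectors are not normalised, so that Gram matrices with integer entries can be used directly. -/
structure IsAlmostOrthogonal (𝕜 : Type*) [RCLike 𝕜] [InnerProductSpace 𝕜 E] (s t : ℝ)
    (e : ι → E) : Prop where
  nonneg_diag : 0 ≤ s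
  nonneg_offDiag : 0 ≤ t
  inner_self : ∀ i, ⟪e i, e i⟫_𝕜 = (s : 𝕜)
  norm_inner_le : ∀ i j, i ≠ j → ‖⟪e i, e j⟫_𝕜‖ ≤ t

variable {s t : ℝ} {e f : ι → E}

theorem norm_inner_sum_smul_le {v : E} {y : ι → 𝕜} (h : ∀ j, ‖⟪v, e j⟫_𝕜‖ ≤ t) :
    ‖⟪v, ∑ j, y j • e j⟫_𝕜‖ ≤ t * ∑ j, ‖y j‖ := by
  rw [inner_sum, Finset.mul_sum]
  refine norm_sum_le_of_le _ fun j _ => ?_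
  rw [inner_smul_right, norm_mul, mul_comm]
  exact mul_le_mul_of_nonneg_right (h j) (norm_nonneg _)

namespace IsAlmostOrthogonal

theorem norm_inner_sum_smul_sub_le (he : IsAlmostOrthogonal 𝕜 s t e) (y : ι → 𝕜) (i : ι) :
    ‖⟪e i, ∑ j, y j • e j⟫_𝕜 - s * y i‖ ≤ t * ∑ j, ‖y j‖ := by
  classical
  have hsplit : ⟪e i, ∑ j, y j • e j⟫_𝕜 - s * y i =
      ∑ j ∈ Finset.univ.erase i, y j * ⟪e i, e j⟫_𝕜 := by
    rw [inner_sum, ← Finset.add_sum_erase _ _ (Finset.mem_univ i), inner_smul_right,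
      he.inner_self, mul_comm (y i), add_sub_cancel_left]
    simp only [inner_smul_right]
  rw [hsplit]
  calc ‖∑ j ∈ Finset.univ.erase i, y j * ⟪e i, e j⟫_𝕜‖
      ≤ ∑ j ∈ Finset.univ.erase i, t * ‖y j‖ := by
        refine norm_sum_le_of_le _ fun j hj => ?_
        rw [norm_mul, mul_comm]
        exact mul_le_mul_of_nonneg_right (he.norm_inner_le i j (Finset.ne_of_mem_erase hj).symm)
          (norm_nonneg _)
    _ ≤ ∑ j, t * ‖y j‖ :=
        Finset.sum_le_sum_of_subset_of_nonneg (Finset.erase_subset i _)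
          fun j _ _ => mul_nonneg he.nonneg_offDiag (norm_nonneg _)
    _ = t * ∑ j, ‖y j‖ := (Finset.mul_sum _ _ _).symm

theorem sum_norm_sq_sub_le_norm_sum_smul_sq (he : IsAlmostOrthogonal 𝕜 s t e) (y : ι → 𝕜) :
    s * ∑ i, ‖y i‖ ^ 2 - t * (∑ i, ‖y i‖) ^ 2 ≤ ‖∑ i, y i • e i‖ ^ 2 := by
  set Y := ∑ j, y j • e j with hY
  have hterm : ∀ i, s * ‖y i‖ ^ 2 - ‖y i‖ * (t * ∑ j, ‖y j‖) ≤ RCLike.re ⟪y i • e i, Y⟫_𝕜 := by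
    intro i
    have hdecomp : ⟪y i • e i, Y⟫_𝕜 =
        ((s * ‖y i‖ ^ 2 : ℝ) : 𝕜) + (starRingEnd 𝕜) (y i) * (⟪e i, Y⟫_𝕜 - s * y i) := by
      push_cast
      rw [inner_smul_left, ← RCLike.conj_mul]
      ring
    rw [hdecomp, map_add, RCLike.ofReal_re, sub_eq_add_neg, add_le_add_iff_left]
    refine neg_le_of_abs_le ((RCLike.abs_re_le_norm _).trans ?_)
    rw [norm_mul, RCLike.norm_conj]
    exact mul_le_mul_of_nonneg_left (he.norm_inner_sum_smul_sub_le y i) (norm_nonneg _)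
  calc s * ∑ i, ‖y i‖ ^ 2 - t * (∑ i, ‖y i‖) ^ 2
      = ∑ i, (s * ‖y i‖ ^ 2 - ‖y i‖ * (t * ∑ j, ‖y j‖)) := by
        rw [Finset.sum_sub_distrib, ← Finset.mul_sum, ← Finset.sum_mul]
        ring
    _ ≤ ∑ i, RCLike.re ⟪y i • e i, Y⟫_𝕜 := Finset.sum_le_sum fun i _ => hterm i
    _ = ‖Y‖ ^ 2 := by rw [← map_sum, ← sum_inner, ← hY, inner_self_eq_norm_sq]

theorem sum_norm_sq_le_norm_sum_smul_sq (he : IsAlmostOrthogonal 𝕜 s t e) (y : ι → 𝕜) :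
    (s - Fintype.card ι * t) * (∑ i, ‖y i‖) ^ 2 ≤ Fintype.card ι * ‖∑ i, y i • e i‖ ^ 2 := by
  have hcauchy : (∑ i, ‖y i‖) ^ 2 ≤ Fintype.card ι * ∑ i, ‖y i‖ ^ 2 := by
    simpa using sq_sum_le_card_mul_sum_sq (s := Finset.univ) (f := fun i => ‖y i‖)
  have hlower := mul_le_mul_of_nonneg_left (he.sum_norm_sq_sub_le_norm_sum_smul_sq y)
    (Nat.cast_nonneg (α := ℝ) (Fintype.card ι))
  have hs := mul_le_mul_of_nonneg_left hcauchy he.nonneg_diag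
  linarith

theorem norm_inner_le_of_forall_norm_inner_le (he : IsAlmostOrthogonal 𝕜 s t e)
    (hf : IsAlmostOrthogonal 𝕜 s t f) {y z : ι → 𝕜}
    (h : ∀ i, ‖⟪f i, ∑ j, y j • e j⟫_𝕜‖ ≤ t * ∑ j, ‖y j‖) :
    (s - Fintype.card ι * t) * ‖⟪∑ i, z i • f i, ∑ j, y j • e j⟫_𝕜‖ ≤
      Fintype.card ι * t * (‖∑ i, z i • f i‖ * ‖∑ j, y j • e j‖) := by
  have ht := he.nonneg_offDiag
  rcases le_total (s - Fintype.card ι * t) 0 with hneg | hpos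
  · exact (mul_nonpos_of_nonpos_of_nonneg hneg (norm_nonneg _)).trans (by positivity)
  set Y := ∑ j, y j • e j
  set Z := ∑ i, z i • f i with hZ
  have hinner : ‖⟪Z, Y⟫_𝕜‖ ≤ t * ((∑ i, ‖z i‖) * ∑ j, ‖y j‖) := by
    rw [hZ, sum_inner, Finset.sum_mul, Finset.mul_sum]
    refine norm_sum_le_of_le _ fun i _ => ?_
    rw [inner_smul_left, norm_mul, RCLike.norm_conj, mul_left_comm]
    exact mul_le_mul_of_nonneg_left (h i) (norm_nonneg _)
  have hprod : (s - Fintype.card ι * t) * ((∑ i, ‖z i‖) * ∑ j, ‖y j‖) ≤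
      Fintype.card ι * (‖Z‖ * ‖Y‖) := by
    refine le_of_sq_le_sq ?_ (by positivity)
    calc _ = (s - Fintype.card ι * t) * (∑ i, ‖z i‖) ^ 2 *
          ((s - Fintype.card ι * t) * (∑ j, ‖y j‖) ^ 2) := by ring
      _ ≤ Fintype.card ι * ‖Z‖ ^ 2 * (Fintype.card ι * ‖Y‖ ^ 2) :=
          mul_le_mul (hf.sum_norm_sq_le_norm_sum_smul_sq z)
            (he.sum_norm_sq_le_norm_sum_smul_sq y) (by positivity) (by positivity)
      _ = _ := by ring
  calc _ ≤ (s - Fintype.card ι * t) * (t * ((∑ i, ‖z i‖) * ∑ j, ‖y j‖)) :=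
        mul_le_mul_of_nonneg_left hinner hpos
    _ = t * ((s - Fintype.card ι * t) * ((∑ i, ‖z i‖) * ∑ j, ‖y j‖)) := by ring
    _ ≤ t * (Fintype.card ι * (‖Z‖ * ‖Y‖)) := mul_le_mul_of_nonneg_left hprod ht
    _ = _ := by ring

end IsAlmostOrthogonal

end AlmostOrthogonal

section ProjectionAngle

open LinearMap (range)

variable {𝕜 E ι : Type*} [RCLike 𝕜] [NormedAddCommGroup E] [InnerProductSpace 𝕜 E]
  {P Q R : E →ₗ[𝕜] E}

theorem apply_eq_self_of_mem_range (hP : P.IsSymmetricProjection) {x : E} (hx : x ∈ range P) :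
    P x = x :=
  (LinearMap.IsIdempotentElem.mem_range_iff hP.isIdempotentElem).mp hx

theorem norm_apply_le_of_isSymmetricProjection (hP : P.IsSymmetricProjection) (x : E) :
    ‖P x‖ ≤ ‖x‖ := by
  obtain ⟨_, hproj⟩ := LinearMap.isSymmetricProjection_iff_eq_coe_starProjection_range.mp hP
  rw [hproj]
  exact Submodule.norm_starProjection_apply_le _ x

theorem norm_inner_apply_self (hP : P.IsSymmetricProjection) (x : E) :
    ‖⟪P x, x⟫_𝕜‖ = ‖P x‖ ^ 2 := by
  have hPP : P (P x) = P x := apply_eq_self_of_mem_range hP (LinearMap.mem_range_self P x)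
  rw [← hPP, hP.isSymmetric, hPP, inner_self_eq_norm_sq_to_K, norm_pow, RCLike.norm_ofReal,
    abs_norm]

theorem comp_sub_apply_eq_of_range_le (hQ : Q.IsSymmetricProjection) (hRQ : range R ≤ range Q)
    (x : E) : (Q ∘ₗ P - R) x = Q ((P - R) x) := by
  rw [LinearMap.sub_apply, LinearMap.sub_apply, LinearMap.comp_apply, map_sub,
    apply_eq_self_of_mem_range hQ (hRQ (LinearMap.mem_range_self R x))]

theorem norm_comp_sub_apply_le (hP : P.IsSymmetricProjection) (hQ : Q.IsSymmetricProjection)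
    (hR : R.IsSymmetricProjection) (hRP : range R ≤ range P) (hRQ : range R ≤ range Q) (x : E) :
    ‖(Q ∘ₗ P - R) x‖ ≤ ‖x‖ := by
  rw [comp_sub_apply_eq_of_range_le hQ hRQ]
  exact (norm_apply_le_of_isSymmetricProjection hQ _).trans
    (norm_apply_le_of_isSymmetricProjection (hR.sub_of_range_le_range hP hRP) x)

theorem inner_sub_apply_eq_zero (hP : P.IsSymmetricProjection) (hR : R.IsSymmetricProjection)
    (hRP : range R ≤ range P) {v : E} (hv : v ∈ range R) (x : E) : ⟪v, (P - R) x⟫_𝕜 = 0 := by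
  rw [← (hP.isSymmetric.sub hR.isSymmetric) v x, LinearMap.sub_apply,
    apply_eq_self_of_mem_range hP (hRP hv), apply_eq_self_of_mem_range hR hv, sub_self,
    inner_zero_left]

/-- The vectors `f i` in `range R` do not contribute, since `(P - R) x` is orthogonal to them. -/
theorem norm_comp_sub_apply_le_of_isAlmostOrthogonal [Fintype ι] {s t : ℝ} {e f : ι → E}
    (hP : P.IsSymmetricProjection) (hQ : Q.IsSymmetricProjection) (hR : R.IsSymmetricProjection)
    (hRP : range R ≤ range P) (hRQ : range R ≤ range Q)
    (he : IsAlmostOrthogonal 𝕜 s t e) (hf : IsAlmostOrthogonal 𝕜 s t f)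
    (hPe : range P ≤ Submodule.span 𝕜 (Set.range e))
    (hQf : range Q ≤ Submodule.span 𝕜 (Set.range f))
    (hfe : ∀ i, f i ∈ range R ∨ ∀ j, ‖⟪f i, e j⟫_𝕜‖ ≤ t) (x : E) :
    s * ‖(Q ∘ₗ P - R) x‖ ≤ 2 * Fintype.card ι * t * ‖x‖ := by
  have ht := he.nonneg_offDiag
  have hle := norm_comp_sub_apply_le hP hQ hR hRP hRQ x
  rw [comp_sub_apply_eq_of_range_le hQ hRQ] at hle ⊢
  obtain ⟨Y, hY⟩ : ∃ Y, (P - R) x = Y := ⟨_, rfl⟩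
  rw [hY] at hle ⊢
  have hYx : ‖Y‖ ≤ ‖x‖ :=
    hY ▸ norm_apply_le_of_isSymmetricProjection (hR.sub_of_range_le_range hP hRP) x
  have hYP : Y ∈ range P :=
    hY ▸ sub_mem (LinearMap.mem_range_self P x) (hRP (LinearMap.mem_range_self R x))
  obtain ⟨y, hy⟩ := (Submodule.mem_span_range_iff_exists_fun 𝕜).mp (hPe hYP)
  obtain ⟨z, hz⟩ := (Submodule.mem_span_range_iff_exists_fun 𝕜).mp
    (hQf (LinearMap.mem_range_self Q Y))
  have hsmall : ∀ i, ‖⟪f i, ∑ j, y j • e j⟫_𝕜‖ ≤ t * ∑ j, ‖y j‖ := by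
    intro i
    rcases hfe i with hi | hi
    · rw [hy, ← hY, inner_sub_apply_eq_zero hP hR hRP hi, norm_zero]
      positivity
    · exact norm_inner_sum_smul_le hi
  have hinner := he.norm_inner_le_of_forall_norm_inner_le hf (z := z) hsmall
  rw [hy, hz, norm_inner_apply_self hQ] at hinner
  have hangle : (s - Fintype.card ι * t) * ‖Q Y‖ ≤ Fintype.card ι * t * ‖Y‖ := by
    rcases (norm_nonneg (Q Y)).eq_or_lt with h0 | h0
    · rw [← h0, mul_zero]
      positivity
    · refine le_of_mul_le_mul_right ?_ h0
      linarith
  have hnt : 0 ≤ Fintype.card ι * t := by positivity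
  linarith [mul_le_mul_of_nonneg_left hle hnt, mul_le_mul_of_nonneg_left hYx hnt]

end ProjectionAngle

section HilbertSchmidt

open scoped ComplexOrder

/-- The Hilbert–Schmidt inner product `tr(X† Y)` on matrices. -/
@[reducible]
def hsInnerCore (n : Type*) [Fintype n] : InnerProductSpace.Core ℂ (Matrix n n ℂ) where
  inner X Y := (Xᴴ * Y).trace
  conj_inner_symm X Y := by
    rw [starRingEnd_apply, ← trace_conjTranspose, conjTranspose_mul, conjTranspose_conjTranspose]
  re_inner_nonneg X :=
    (RCLike.nonneg_iff.mp (posSemidef_conjTranspose_mul_self X).trace_nonneg).1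
  add_left X Y Z := by rw [conjTranspose_add, Matrix.add_mul, trace_add]
  smul_left X Y c := by
    rw [conjTranspose_smul, Matrix.smul_mul, trace_smul, smul_eq_mul, starRingEnd_apply]
  definite _ := trace_conjTranspose_mul_self_eq_zero_iff.mp

/-- Matrices with the Hilbert–Schmidt norm, which is `hsNorm` definitionally. -/
@[reducible]
def hsNormedAddCommGroup (n : Type*) [Fintype n] : NormedAddCommGroup (Matrix n n ℂ) :=
  (hsInnerCore n).toNormedAddCommGroup

attribute [local instance] hsNormedAddCommGroup

/-- Matrices with the Hilbert–Schmidt inner product. -/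
@[reducible]
def hsInnerProductSpace (n : Type*) [Fintype n] : InnerProductSpace ℂ (Matrix n n ℂ) :=
  InnerProductSpace.ofCore (hsInnerCore n).toCore

attribute [local instance] hsInnerProductSpace

theorem inner_eq_trace {n : Type*} [Fintype n] (X Y : Matrix n n ℂ) :
    ⟪X, Y⟫_ℂ = (Xᴴ * Y).trace := rfl

end HilbertSchmidt

section TensorPow

variable {n : Type} {k : ℕ}

theorem tensorPow_apply (U : Matrix n n ℂ) (x y : Fin k → n) :
    tensorPow k U x y = ∏ i, U (x i) (y i) := rfl

theorem tensorPow_conjTranspose (U : Matrix n n ℂ) : tensorPow k Uᴴ = (tensorPow k U)ᴴ := by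
  ext x y
  simp only [tensorPow_apply, conjTranspose_apply, star_prod]

theorem tensorPow_mul [Fintype n] (U V : Matrix n n ℂ) :
    tensorPow k (U * V) = tensorPow k U * tensorPow k V := by
  ext x y
  simp only [tensorPow_apply, Matrix.mul_apply, ← Finset.prod_mul_distrib]
  rw [Finset.prod_univ_sum, Fintype.piFinset_univ]

theorem tensorPow_diagonal [DecidableEq n] (z : n → ℂ) :
    tensorPow k (diagonal z) = diagonal fun x => ∏ i, z (x i) := by
  ext x y
  simp only [tensorPow_apply, diagonal_apply, Finset.prod_ite_zero, Finset.mem_univ, true_imp_iff,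
    funext_iff]

theorem tensorPow_one [DecidableEq n] : tensorPow k (1 : Matrix n n ℂ) = 1 := by
  simp only [← diagonal_one, tensorPow_diagonal, Finset.prod_const_one]

variable [Fintype n]

/-- The conjugation `X ↦ U^{⊗k} X (U^{⊗k})†`, of which the twirl is the Haar average. -/
def tensorConj (k : ℕ) (U : Matrix n n ℂ) :
    Matrix (Fin k → n) (Fin k → n) ℂ →ₗ[ℂ] Matrix (Fin k → n) (Fin k → n) ℂ :=
  LinearMap.mulLeftRight ℂ (tensorPow k U, (tensorPow k U)ᴴ)

theorem tensorConj_apply (U : Matrix n n ℂ) (X : Matrix (Fin k → n) (Fin k → n) ℂ) :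
    tensorConj k U X = tensorPow k U * X * (tensorPow k U)ᴴ := rfl

theorem tensorConj_mul (U V : Matrix n n ℂ) (X : Matrix (Fin k → n) (Fin k → n) ℂ) :
    tensorConj k (U * V) X = tensorConj k U (tensorConj k V X) := by
  simp only [tensorConj_apply, tensorPow_mul, conjTranspose_mul, Matrix.mul_assoc]

theorem tensorConj_eq_self_iff_commute [DecidableEq n] {U : Matrix n n ℂ}
    (hU : U ∈ unitaryGroup n ℂ) (X : Matrix (Fin k → n) (Fin k → n) ℂ) :
    tensorConj k U X = X ↔ Commute (tensorPow k U) X := by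
  have hleft : (tensorPow k U)ᴴ * tensorPow k U = 1 := by
    rw [← tensorPow_conjTranspose, ← tensorPow_mul, ← star_eq_conjTranspose,
      mem_unitaryGroup_iff'.mp hU, tensorPow_one]
  have hright : tensorPow k U * (tensorPow k U)ᴴ = 1 := mul_eq_one_comm.mp hleft
  rw [tensorConj_apply]
  constructor <;> intro h
  · have hmul := congr($h * tensorPow k U)
    rwa [Matrix.mul_assoc _ _ (tensorPow k U), hleft, mul_one] at hmul
  · rw [h.eq, Matrix.mul_assoc, hright, mul_one]

end TensorPow

section HaarMeasure

variable {n : Type} [Fintype n] [DecidableEq n]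

instance isMulRightInvariant_haarUnitary : (haarUnitary n).IsMulRightInvariant := by
  refine ⟨fun g => ?_⟩
  have := Measure.isProbabilityMeasure_map (μ := haarUnitary n)
    (continuous_mul_const g).measurable.aemeasurable
  have : (Measure.map (· * g) (haarUnitary n)).IsOpenPosMeasure :=
    (continuous_mul_const g).isOpenPosMeasure_map (Group.mulRight_bijective g).surjective
  have : (Measure.map (· * g) (haarUnitary n)).IsHaarMeasure := {}
  exact Measure.isHaarMeasure_eq_of_isProbabilityMeasure _ _

instance isInvInvariant_haarUnitary : (haarUnitary n).IsInvInvariant := by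
  have : IsProbabilityMeasure (haarUnitary n).inv := ⟨by simp⟩
  have : (haarUnitary n).inv.IsOpenPosMeasure := ⟨fun U hU hne => by
    rw [Measure.inv_apply]
    exact hU.inv.measure_ne_zero _ hne.inv⟩
  have : (haarUnitary n).inv.IsHaarMeasure := {}
  exact ⟨Measure.isHaarMeasure_eq_of_isProbabilityMeasure _ _⟩

end HaarMeasure

section Twirl

attribute [local instance] hsNormedAddCommGroup hsInnerProductSpace

variable {n : Type} [Fintype n] {k : ℕ}

theorem inner_tensorConj_left (U : Matrix n n ℂ) (X Y : Matrix (Fin k → n) (Fin k → n) ℂ) :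
    ⟪tensorConj k U X, Y⟫_ℂ = ⟪X, tensorConj k Uᴴ Y⟫_ℂ := by
  simp only [inner_eq_trace, tensorConj_apply, tensorPow_conjTranspose, conjTranspose_mul,
    conjTranspose_conjTranspose, Matrix.mul_assoc]
  rw [trace_mul_comm]
  simp only [Matrix.mul_assoc]

variable [DecidableEq n]

theorem linearMap_twirl (L : Matrix (Fin k → n) (Fin k → n) ℂ →ₗ[ℂ] ℂ)
    (X : Matrix (Fin k → n) (Fin k → n) ℂ) :
    L (twirl n k X) = ∫ U : unitaryGroup n ℂ, L (tensorConj k U X) ∂(haarUnitary n) := by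
  have hL : ∀ M, L M = ∑ x, ∑ y, M x y * L (Matrix.single x y 1) := by
    intro M
    conv_lhs => rw [matrix_eq_sum_single M]
    simp only [map_sum]
    refine Finset.sum_congr rfl fun x _ => Finset.sum_congr rfl fun y _ => ?_
    rw [← smul_eq_mul, ← map_smul, smul_single, smul_eq_mul, mul_one]
  have hint : ∀ x y, Integrable (fun U : unitaryGroup n ℂ =>
      tensorConj k (U : Matrix n n ℂ) X x y * L (Matrix.single x y 1)) (haarUnitary n) :=
    fun x y => (integrable_twirl_entry k X x y).mul_const _
  simp only [hL (tensorConj _ _ _)]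
  rw [hL, integral_finsetSum _ fun x _ => integrable_finsetSum _ fun y _ => hint x y]
  refine Finset.sum_congr rfl fun x _ => ?_
  rw [integral_finsetSum _ fun y _ => hint x y]
  exact Finset.sum_congr rfl fun y _ => (integral_mul_const _ _).symm

theorem map_twirl_of_forall_map_tensorConj {F : Type*} [AddCommGroup F] [Module ℂ F]
    {L : Matrix (Fin k → n) (Fin k → n) ℂ →ₗ[ℂ] F} {X : Matrix (Fin k → n) (Fin k → n) ℂ}
    (h : ∀ U ∈ unitaryGroup n ℂ, L (tensorConj k U X) = L X) : L (twirl n k X) = L X := by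
  rw [← sub_eq_zero, ← Module.forall_dual_apply_eq_zero_iff ℂ]
  intro φ
  have hφ := linearMap_twirl (φ ∘ₗ L) X
  simp only [LinearMap.comp_apply, fun U : unitaryGroup n ℂ => h U U.2, integral_const,
    probReal_univ, one_smul] at hφ
  rw [map_sub, hφ, sub_self]

theorem twirl_eq_self_of_forall_commute {X : Matrix (Fin k → n) (Fin k → n) ℂ}
    (h : ∀ U ∈ unitaryGroup n ℂ, Commute (tensorPow k U) X) : twirl n k X = X :=
  map_twirl_of_forall_map_tensorConj (L := LinearMap.id) fun U hU =>
    (tensorConj_eq_self_iff_commute hU X).mpr (h U hU)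

theorem tensorConj_twirl {V : Matrix n n ℂ} (hV : V ∈ unitaryGroup n ℂ)
    (X : Matrix (Fin k → n) (Fin k → n) ℂ) : tensorConj k V (twirl n k X) = twirl n k X := by
  refine ext_inner_left ℂ fun Y => ?_
  have hleft := linearMap_twirl (innerₛₗ ℂ Y ∘ₗ tensorConj k V) X
  have hright := linearMap_twirl (innerₛₗ ℂ Y) X
  simp only [LinearMap.comp_apply, innerₛₗ_apply_apply, ← tensorConj_mul] at hleft hright
  rw [hleft, hright]
  exact integral_mul_left_eq_self
    (fun U : unitaryGroup n ℂ => ⟪Y, tensorConj k (U : Matrix n n ℂ) X⟫_ℂ) ⟨V, hV⟩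

theorem twirl_tensorConj {V : Matrix n n ℂ} (hV : V ∈ unitaryGroup n ℂ)
    (X : Matrix (Fin k → n) (Fin k → n) ℂ) : twirl n k (tensorConj k V X) = twirl n k X := by
  refine ext_inner_left ℂ fun Y => ?_
  have hleft := linearMap_twirl (innerₛₗ ℂ Y) (tensorConj k V X)
  have hright := linearMap_twirl (innerₛₗ ℂ Y) X
  simp only [innerₛₗ_apply_apply, ← tensorConj_mul] at hleft hright
  rw [hleft, hright]
  exact integral_mul_right_eq_self
    (fun U : unitaryGroup n ℂ => ⟪Y, tensorConj k (U : Matrix n n ℂ) X⟫_ℂ) ⟨V, hV⟩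

theorem commute_tensorPow_twirl {V : Matrix n n ℂ} (hV : V ∈ unitaryGroup n ℂ)
    (X : Matrix (Fin k → n) (Fin k → n) ℂ) : Commute (tensorPow k V) (twirl n k X) :=
  (tensorConj_eq_self_iff_commute hV _).mp (tensorConj_twirl hV X)

theorem isSymmetric_twirl : (twirl n k).IsSymmetric := by
  intro X Y
  have hX := linearMap_twirl (innerₛₗ ℂ Y) X
  have hY := linearMap_twirl (innerₛₗ ℂ X) Y
  simp only [innerₛₗ_apply_apply] at hX hY
  rw [← inner_conj_symm, hX, hY, ← integral_conj,
    ← integral_inv_eq_self fun U : unitaryGroup n ℂ => ⟪X, tensorConj k (U : Matrix n n ℂ) Y⟫_ℂ]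
  simp only [inner_conj_symm, inner_tensorConj_left]
  rfl

theorem isSymmetricProjection_twirl : (twirl n k).IsSymmetricProjection where
  isIdempotentElem := LinearMap.ext fun X =>
    twirl_eq_self_of_forall_commute fun _ hU => commute_tensorPow_twirl hU X
  isSymmetric := isSymmetric_twirl

end Twirl

section PermOp

variable {n : Type} [DecidableEq n] {k : ℕ}

/-- The operator on `(ℂⁿ)^{⊗k}` that permutes the tensor factors. -/
def permOp (σ : Equiv.Perm (Fin k)) : Matrix (Fin k → n) (Fin k → n) ℂ :=
  Matrix.of fun x y => if x = y ∘ σ then 1 else 0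

theorem permOp_apply (σ : Equiv.Perm (Fin k)) (x y : Fin k → n) :
    permOp σ x y = if x = y ∘ σ then 1 else 0 := rfl

theorem commute_tensorPow_permOp [Fintype n] (U : Matrix n n ℂ) (σ : Equiv.Perm (Fin k)) :
    Commute (tensorPow k U) (permOp σ) := by
  have hcomp : ∀ x y : Fin k → n, x = y ∘ σ ↔ y = x ∘ σ.symm := fun x y => by
    rw [eq_comm, ← Equiv.eq_comp_symm]
  ext x y
  simp only [Matrix.mul_apply, permOp_apply, hcomp x, mul_ite, mul_one, mul_zero, ite_mul,
    one_mul, zero_mul, Finset.sum_ite_eq', Finset.mem_univ, if_true]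
  simp only [tensorPow_apply, Function.comp_apply]
  rw [← Equiv.prod_comp σ.symm]
  simp only [Equiv.apply_symm_apply]

end PermOp

section Commutant

variable {n : Type} {k : ℕ}

theorem exists_perm_of_card_fiber_eq [DecidableEq n] {x y : Fin k → n}
    (h : ∀ a, Fintype.card {i // x i = a} = Fintype.card {i // y i = a}) :
    ∃ σ : Equiv.Perm (Fin k), x = y ∘ σ :=
  ⟨Equiv.ofFiberEquiv fun a => Fintype.equivOfCardEq (h a),
    funext fun i => (Equiv.ofFiberEquiv_map _ i).symm⟩

theorem prod_update_one [DecidableEq n] (x : Fin k → n) (a : n) (w : ℂ) :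
    ∏ i, Function.update (fun _ => (1 : ℂ)) a w (x i) = w ^ Fintype.card {i // x i = a} := by
  simp only [Function.update_apply, Finset.prod_ite, Finset.prod_const, one_pow, mul_one,
    Fintype.card_subtype]

theorem exists_perm_of_prod_eq {x y : Fin k → n}
    (h : ∀ z : n → ℂ, (∀ a, ‖z a‖ = 1) → ∏ i, z (x i) = ∏ i, z (y i)) :
    ∃ σ : Equiv.Perm (Fin k), x = y ∘ σ := by
  classical
  obtain ⟨w, hw⟩ : ∃ w : ℂ, IsPrimitiveRoot w (k + 1) :=
    ⟨_, Complex.isPrimitiveRoot_exp (k + 1) k.succ_ne_zero⟩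
  refine exists_perm_of_card_fiber_eq fun a => ?_
  have hpow := h (Function.update (fun _ => 1) a w) fun b => by
    rw [Function.update_apply]
    split_ifs
    exacts [hw.norm'_eq_one k.succ_ne_zero, norm_one]
  rw [prod_update_one, prod_update_one] at hpow
  have hlt : ∀ u : Fin k → n, Fintype.card {i // u i = a} < k + 1 := fun u =>
    Nat.lt_succ_of_le ((Fintype.card_subtype_le _).trans_eq (Fintype.card_fin k))
  exact hw.pow_inj (hlt x) (hlt y) hpow

theorem exists_tensorPow_apply_comp_eq_permOp [DecidableEq n] {f : Fin k → n}
    (hf : Function.Injective f) (y : Fin k → n) :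
    ∃ M : Matrix n n ℂ, ∀ x (σ : Equiv.Perm (Fin k)), tensorPow k M x (f ∘ σ) = permOp σ x y := by
  refine ⟨Matrix.of fun a b => if ∃ i, f i = b ∧ y i = a then 1 else 0, fun x σ => ?_⟩
  simp only [tensorPow_apply, Matrix.of_apply, Function.comp_apply, hf.eq_iff, exists_eq_left,
    Finset.prod_ite_zero, Finset.mem_univ, true_imp_iff, Finset.prod_const_one, permOp_apply]
  refine if_congr ?_ rfl rfl
  simp only [funext_iff, Function.comp_apply, eq_comm]

theorem exists_polynomial_eval_eq_tensorPow (A B : Matrix n n ℂ)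
    (x y : Fin k → n) :
    ∃ p : Polynomial ℂ, ∀ s, p.eval s = tensorPow k (A + s • B) x y :=
  ⟨∏ i, (Polynomial.C (A (x i) (y i)) + Polynomial.X * Polynomial.C (B (x i) (y i))), fun s => by
    simp only [Polynomial.eval_prod, Polynomial.eval_add, Polynomial.eval_mul, Polynomial.eval_C,
      Polynomial.eval_X, tensorPow_apply, Matrix.add_apply, Matrix.smul_apply, smul_eq_mul]⟩

variable [Fintype n] [DecidableEq n] {C : Matrix (Fin k → n) (Fin k → n) ℂ}

theorem diagonal_mem_unitaryGroup {z : n → ℂ} (hz : ∀ a, ‖z a‖ = 1) :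
    diagonal z ∈ unitaryGroup n ℂ := by
  rw [mem_unitaryGroup_iff, star_eq_conjTranspose, diagonal_conjTranspose, diagonal_mul_diagonal,
    ← diagonal_one]
  congr 1
  ext a
  simp [Complex.mul_conj', hz]

theorem exists_perm_of_commute_unitary
    (h : ∀ U ∈ unitaryGroup n ℂ, Commute (tensorPow k U) C) {x y : Fin k → n}
    (hxy : C x y ≠ 0) : ∃ σ : Equiv.Perm (Fin k), x = y ∘ σ := by
  refine exists_perm_of_prod_eq fun z hz => mul_left_cancel₀ hxy ?_
  have hentry := congr($((h _ (diagonal_mem_unitaryGroup hz)).eq) x y)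
  rwa [tensorPow_diagonal, diagonal_mul, mul_diagonal, mul_comm] at hentry

theorem commute_tensorPow_diagonal
    (h : ∀ U ∈ unitaryGroup n ℂ, Commute (tensorPow k U) C) (z : n → ℂ) :
    Commute (tensorPow k (diagonal z)) C := by
  ext x y
  rw [tensorPow_diagonal, diagonal_mul, mul_diagonal]
  by_cases hxy : C x y = 0
  · rw [hxy, mul_zero, zero_mul]
  · obtain ⟨σ, rfl⟩ := exists_perm_of_commute_unitary h hxy
    rw [mul_comm, ← Equiv.prod_comp σ fun i => z (y i)]
    rfl

theorem commute_tensorPow_of_isHermitian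
    (h : ∀ U ∈ unitaryGroup n ℂ, Commute (tensorPow k U) C) {H : Matrix n n ℂ}
    (hH : H.IsHermitian) : Commute (tensorPow k H) C := by
  rw [hH.spectral_theorem, Unitary.conjStarAlgAut_apply, tensorPow_mul, tensorPow_mul]
  exact ((h _ hH.eigenvectorUnitary.2).mul_left (commute_tensorPow_diagonal h _)).mul_left
    (h _ (star hH.eigenvectorUnitary).2)

/-- Writing `M = A + iB` with `A` and `B` Hermitian, the commutator of `C` with `(A + sB)^{⊗k}` is
polynomial in `s` and vanishes for all real `s`, hence also at `s = i`. -/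
theorem commute_tensorPow_of_forall_unitary
    (h : ∀ U ∈ unitaryGroup n ℂ, Commute (tensorPow k U) C) (M : Matrix n n ℂ) :
    Commute (tensorPow k M) C := by
  obtain ⟨A, B, hA, hB, hM⟩ : ∃ A B : Matrix n n ℂ, A.IsHermitian ∧ B.IsHermitian ∧
      A + Complex.I • B = M :=
    ⟨_, _, (realPart M).2, (imaginaryPart M).2, realPart_add_I_smul_imaginaryPart M⟩
  choose T hT using exists_polynomial_eval_eq_tensorPow (k := k) A B
  ext x y
  let p : Polynomial ℂ := ∑ z, T x z * Polynomial.C (C z y) - ∑ z, Polynomial.C (C x z) * T z y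
  have hp : ∀ s, p.eval s =
      (tensorPow k (A + s • B) * C) x y - (C * tensorPow k (A + s • B)) x y := by
    intro s
    simp only [p, Polynomial.eval_sub, Polynomial.eval_finsetSum, Polynomial.eval_mul,
      Polynomial.eval_C, hT, Matrix.mul_apply]
  have hp0 : p = 0 := by
    refine Polynomial.eq_zero_of_infinite_isRoot p
      ((Set.infinite_range_of_injective Complex.ofReal_injective).mono ?_)
    rintro _ ⟨s, rfl⟩
    have hs : (A + (s : ℂ) • B).IsHermitian :=
      hA.add (hB.smul (Complex.conj_ofReal s))
    rw [Set.mem_ofPred_eq, Polynomial.IsRoot, hp, (commute_tensorPow_of_isHermitian h hs).eq,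
      sub_self]
  rw [← sub_eq_zero, ← hM, ← hp, hp0, Polynomial.eval_zero]

/-- Compare the `(x, f)` entries of `C M^{⊗k}` and `M^{⊗k} C`, where `M` sends the `i`-th vector of
`f` to the `i`-th vector of `y`. -/
theorem apply_eq_sum_permOp_of_commute_unitary
    (h : ∀ U ∈ unitaryGroup n ℂ, Commute (tensorPow k U) C) {f : Fin k → n}
    (hf : Function.Injective f) (x y : Fin k → n) :
    C x y = ∑ σ : Equiv.Perm (Fin k), C (f ∘ σ) f * permOp σ x y := by
  obtain ⟨M, hM⟩ := exists_tensorPow_apply_comp_eq_permOp hf y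
  have hMf : ∀ u, tensorPow k M u f = if u = y then 1 else 0 := fun u => hM u 1
  have hinj : Function.Injective fun σ : Equiv.Perm (Fin k) => f ∘ σ :=
    hf.comp_left.comp DFunLike.coe_injective
  calc C x y = (C * tensorPow k M) x f := by
        simp only [Matrix.mul_apply, hMf, mul_ite, mul_one, mul_zero, Finset.sum_ite_eq',
          Finset.mem_univ, if_true]
    _ = (tensorPow k M * C) x f := by rw [(commute_tensorPow_of_forall_unitary h M).eq]
    _ = ∑ σ : Equiv.Perm (Fin k), C (f ∘ σ) f * permOp σ x y := by
        rw [Matrix.mul_apply]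
        refine (Fintype.sum_of_injective _ hinj _ _ (fun z hz => ?_) fun σ => ?_).symm
        · have hz0 : C z f = 0 := by
            by_contra hne
            obtain ⟨σ, hσ⟩ := exists_perm_of_commute_unitary h hne
            exact hz ⟨σ, hσ.symm⟩
          rw [hz0, mul_zero]
        · rw [hM, mul_comm]

theorem mem_span_permOp_of_commute_unitary (hk : k ≤ Fintype.card n)
    (h : ∀ U ∈ unitaryGroup n ℂ, Commute (tensorPow k U) C) :
    C ∈ Submodule.span ℂ (Set.range (permOp : Equiv.Perm (Fin k) → _)) := by
  obtain ⟨f⟩ : Nonempty (Fin k ↪ n) :=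
    Function.Embedding.nonempty_of_card_le (by rwa [Fintype.card_fin])
  refine (Submodule.mem_span_range_iff_exists_fun ℂ).mpr ⟨fun σ => C (f ∘ σ) f, ?_⟩
  ext x y
  simp only [Matrix.sum_apply, Matrix.smul_apply, smul_eq_mul]
  exact (apply_eq_sum_permOp_of_commute_unitary h f.injective x y).symm

theorem twirl_mem_span_permOp (hk : k ≤ Fintype.card n)
    (X : Matrix (Fin k → n) (Fin k → n) ℂ) :
    twirl n k X ∈ Submodule.span ℂ (Set.range (permOp : Equiv.Perm (Fin k) → _)) :=
  mem_span_permOp_of_commute_unitary hk fun _ hU => commute_tensorPow_twirl hU X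

end Commutant

attribute [local instance] hsNormedAddCommGroup hsInnerProductSpace

section InnerMatrix

theorem inner_submatrix_equiv {a b : Type*} [Fintype a] [Fintype b] (e : b ≃ a)
    (X Y : Matrix a a ℂ) : ⟪X.submatrix e e, Y.submatrix e e⟫_ℂ = ⟪X, Y⟫_ℂ := by
  rw [inner_eq_trace, conjTranspose_submatrix, submatrix_mul_equiv, inner_eq_trace]
  exact Equiv.sum_comp e fun i => (Xᴴ * Y) i i

theorem inner_kronecker {a b : Type*} [Fintype a] [Fintype b] (X X' : Matrix a a ℂ)
    (Y Y' : Matrix b b ℂ) : ⟪X ⊗ₖ Y, X' ⊗ₖ Y'⟫_ℂ = ⟪X, X'⟫_ℂ * ⟪Y, Y'⟫_ℂ := by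
  simp only [inner_eq_trace]
  rw [conjTranspose_kronecker, ← mul_kronecker_mul, trace_kronecker]

end InnerMatrix

section SuperTensor

@[elab_as_elim]
theorem kronecker_induction {a b : Type} [Finite a] [Finite b]
    {motive : Matrix (a × b) (a × b) ℂ → Prop} (zero : motive 0)
    (kronecker : ∀ X Y, motive (X ⊗ₖ Y))
    (add : ∀ M N, motive M → motive N → motive (M + N)) (M : Matrix (a × b) (a × b) ℂ) :
    motive M := by
  classical
  have := Fintype.ofFinite a
  have := Fintype.ofFinite b
  rw [← (kroneckerEquiv a b).apply_symm_apply M]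
  induction (kroneckerEquiv a b).symm M using TensorProduct.induction_on with
  | zero => rwa [map_zero]
  | tmul X Y => rw [kroneckerEquiv_tmul]; exact kronecker X Y
  | add x y hx hy => rw [map_add]; exact add _ _ hx hy

variable {a b : Type} [Fintype a] [DecidableEq a] [Fintype b] [DecidableEq b]
  {Φ : Matrix a a ℂ →ₗ[ℂ] Matrix a a ℂ} {Ψ : Matrix b b ℂ →ₗ[ℂ] Matrix b b ℂ}

theorem isSymmetric_superTensor (hΦ : Φ.IsSymmetric) (hΨ : Ψ.IsSymmetric) :
    (superTensor Φ Ψ).IsSymmetric := by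
  intro M N
  induction M using kronecker_induction with
  | zero => rw [map_zero, inner_zero_left, inner_zero_left]
  | add M M' hM hM' => rw [map_add, inner_add_left, inner_add_left, hM, hM']
  | kronecker X Y =>
    induction N using kronecker_induction with
    | zero => rw [map_zero, inner_zero_right, inner_zero_right]
    | add N N' hN hN' => rw [map_add, inner_add_right, inner_add_right, hN, hN']
    | kronecker X' Y' =>
      rw [superTensor_kronecker, superTensor_kronecker, inner_kronecker, inner_kronecker, hΦ, hΨ]

theorem isSymmetricProjection_superTensor (hΦ : Φ.IsSymmetricProjection)
    (hΨ : Ψ.IsSymmetricProjection) : (superTensor Φ Ψ).IsSymmetricProjection where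
  isIdempotentElem := LinearMap.ext fun M => by
    rw [Module.End.mul_apply]
    induction M using kronecker_induction with
    | zero => simp only [map_zero]
    | add M N hM hN => simp only [map_add, hM, hN]
    | kronecker X Y =>
      simp only [superTensor_kronecker, ← Module.End.mul_apply, hΦ.isIdempotentElem.eq,
        hΨ.isIdempotentElem.eq]
  isSymmetric := isSymmetric_superTensor hΦ.isSymmetric hΨ.isSymmetric

theorem superTensor_mem_span {ι κ : Type*} {v : ι → Matrix a a ℂ} {w : κ → Matrix b b ℂ}
    (hΦ : ∀ X, Φ X ∈ Submodule.span ℂ (Set.range v))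
    (hΨ : ∀ Y, Ψ Y ∈ Submodule.span ℂ (Set.range w)) (M : Matrix (a × b) (a × b) ℂ) :
    superTensor Φ Ψ M ∈ Submodule.span ℂ (Set.range fun i : ι × κ => v i.1 ⊗ₖ w i.2) := by
  induction M using kronecker_induction with
  | zero => rw [map_zero]; exact zero_mem _
  | add M N hM hN => rw [map_add]; exact add_mem hM hN
  | kronecker X Y =>
    rw [superTensor_kronecker]
    have h := Submodule.apply_mem_map₂
      (kroneckerBilinear : Matrix a a ℂ →ₗ[ℂ] Matrix b b ℂ →ₗ[ℂ] Matrix (a × b) (a × b) ℂ)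
      (hΦ X) (hΨ Y)
    rw [Submodule.map₂_span_span] at h
    refine Submodule.span_mono ?_ h
    rintro _ ⟨_, ⟨i, rfl⟩, _, ⟨j, rfl⟩, rfl⟩
    exact ⟨(i, j), rfl⟩

end SuperTensor

section GlobalTwirl

variable {k q m : ℕ}

theorem regroup_apply
    (X : Matrix (Fin k → Block q m × Block q m) (Fin k → Block q m × Block q m) ℂ)
    (v w : Full k q m) :
    regroup k q m X v w = X (fun i => (v.1 i, v.2 i)) (fun i => (w.1 i, w.2 i)) := rfl

theorem regroup_mul
    (X Y : Matrix (Fin k → Block q m × Block q m) (Fin k → Block q m × Block q m) ℂ) :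
    regroup k q m (X * Y) = regroup k q m X * regroup k q m Y :=
  (reindexLinearEquiv_mul ℂ ℂ _ _ _ X Y).symm

theorem inner_regroup
    (X Y : Matrix (Fin k → Block q m × Block q m) (Fin k → Block q m × Block q m) ℂ) :
    ⟪regroup k q m X, regroup k q m Y⟫_ℂ = ⟪X, Y⟫_ℂ :=
  inner_submatrix_equiv _ X Y

theorem R_regroup
    (X : Matrix (Fin k → Block q m × Block q m) (Fin k → Block q m × Block q m) ℂ) :
    R k q m (regroup k q m X) = regroup k q m (twirl (Block q m × Block q m) k X) := by
  simp only [R, LinearMap.comp_apply, LinearEquiv.coe_coe, LinearEquiv.symm_apply_apply]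

theorem isSymmetricProjection_R : (R k q m).IsSymmetricProjection where
  isIdempotentElem := LinearMap.ext fun X => by
    obtain ⟨X, rfl⟩ := (regroup k q m).surjective X
    rw [Module.End.mul_apply, R_regroup, R_regroup, ← Module.End.mul_apply,
      isSymmetricProjection_twirl.isIdempotentElem.eq]
  isSymmetric X Y := by
    obtain ⟨X, rfl⟩ := (regroup k q m).surjective X
    obtain ⟨Y, rfl⟩ := (regroup k q m).surjective Y
    rw [R_regroup, R_regroup, inner_regroup, inner_regroup, isSymmetric_twirl]

theorem isSymmetricProjection_P : (P k q m).IsSymmetricProjection :=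
  isSymmetricProjection_superTensor isSymmetricProjection_twirl isSymmetricProjection_twirl

theorem regroup_tensorPow_kronecker (U V : Matrix (Block q m) (Block q m) ℂ) :
    regroup k q m (tensorPow k (U ⊗ₖ V)) = tensorPow k U ⊗ₖ tensorPow k V := by
  ext v w
  simp only [regroup_apply, tensorPow_apply, kroneckerMap_apply, Finset.prod_mul_distrib]

theorem R_tensorConj_kronecker {U V : Matrix (Block q m) (Block q m) ℂ}
    (hU : U ∈ unitaryGroup (Block q m) ℂ) (hV : V ∈ unitaryGroup (Block q m) ℂ)
    (X Y : Matrix (Fin k → Block q m) (Fin k → Block q m) ℂ) :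
    R k q m (tensorConj k U X ⊗ₖ tensorConj k V Y) = R k q m (X ⊗ₖ Y) := by
  obtain ⟨Z, hZ⟩ := (regroup k q m).surjective (X ⊗ₖ Y)
  have hconj : tensorConj k U X ⊗ₖ tensorConj k V Y =
      regroup k q m (tensorConj k (U ⊗ₖ V) Z) := by
    rw [tensorConj_apply (U ⊗ₖ V), ← tensorPow_conjTranspose, conjTranspose_kronecker,
      regroup_mul, regroup_mul, hZ, regroup_tensorPow_kronecker, regroup_tensorPow_kronecker,
      ← mul_kronecker_mul, ← mul_kronecker_mul, tensorPow_conjTranspose, tensorPow_conjTranspose]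
    rfl
  rw [hconj, R_regroup, twirl_tensorConj (kronecker_mem_unitary hU hV), ← hZ, R_regroup]

/-- The product unitaries form a subgroup of the unitaries of `A ⊗ B`, so averaging over them first
does not change the Haar average. -/
theorem R_P (X : Op k q m) : R k q m (P k q m X) = R k q m X := by
  induction X using kronecker_induction with
  | zero => simp only [map_zero]
  | add M N hM hN => simp only [map_add, hM, hN]
  | kronecker X Y =>
    let κ := (kroneckerBilinear : Matrix (Fin k → Block q m) (Fin k → Block q m) ℂ →ₗ[ℂ]
      Matrix (Fin k → Block q m) (Fin k → Block q m) ℂ →ₗ[ℂ] Op k q m)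
    have hright : ∀ X, R k q m (X ⊗ₖ twirl (Block q m) k Y) = R k q m (X ⊗ₖ Y) := fun X =>
      map_twirl_of_forall_map_tensorConj (L := R k q m ∘ₗ κ X) fun V hV => by
        have h := R_tensorConj_kronecker (one_mem _) hV X Y
        rwa [(tensorConj_eq_self_iff_commute (one_mem _) X).mpr
          (by rw [tensorPow_one]; exact Commute.one_left X)] at h
    have hleft : R k q m (twirl (Block q m) k X ⊗ₖ Y) = R k q m (X ⊗ₖ Y) :=
      map_twirl_of_forall_map_tensorConj (L := R k q m ∘ₗ κ.flip Y) fun U hU => by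
        have h := R_tensorConj_kronecker hU (one_mem _) X Y
        rwa [(tensorConj_eq_self_iff_commute (one_mem _) Y).mpr
          (by rw [tensorPow_one]; exact Commute.one_left Y)] at h
    rw [P, superTensor_kronecker, hright, hleft]

theorem P_R (X : Op k q m) : P k q m (R k q m X) = R k q m X := by
  refine ext_inner_left ℂ fun Y => ?_
  rw [← isSymmetricProjection_P.isSymmetric, ← isSymmetricProjection_R.isSymmetric, R_P,
    isSymmetricProjection_R.isSymmetric]

theorem range_R_le_range_P : LinearMap.range (R k q m) ≤ LinearMap.range (P k q m) := by
  rintro _ ⟨X, rfl⟩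
  exact ⟨R k q m X, P_R X⟩

end GlobalTwirl

section Swap

variable {k q m : ℕ}

/-- The exchange of the first `ℓ` qudits of each `A_i` and `B_i`, on basis labels. -/
def swapLabels (ℓ : ℕ) (w : Full k q m) : Full k q m :=
  (fun i j => if j.val < ℓ then w.2 i j else w.1 i j,
    fun i j => if j.val < ℓ then w.1 i j else w.2 i j)

theorem swapLabels_involutive (ℓ : ℕ) :
    Function.Involutive (swapLabels ℓ : Full k q m → Full k q m) := by
  intro w
  ext i j <;> simp only [swapLabels] <;> split_ifs <;> rfl

theorem swapFirst_involutive (ℓ : ℕ) :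
    Function.Involutive (swapFirst ℓ : Block q m × Block q m → _) := by
  intro v
  ext j <;> simp only [swapFirst] <;> split_ifs <;> rfl

theorem of_ite_eq_permMatrix {n : Type} [DecidableEq n] {f : n → n} (hf : f.Involutive) :
    (Matrix.of fun v w => if v = f w then (1 : ℂ) else 0) = hf.toPerm.permMatrix ℂ := by
  ext v w
  simp only [Matrix.of_apply, PEquiv.toMatrix_apply, Equiv.toPEquiv_apply, Option.mem_some_iff,
    hf.coe_toPerm, hf.eq_iff]

theorem swapOp_eq_permMatrix (ℓ : ℕ) :
    swapOp q m ℓ = (swapFirst_involutive ℓ).toPerm.permMatrix ℂ :=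
  of_ite_eq_permMatrix (swapFirst_involutive ℓ)

theorem conjTranspose_swapOp (ℓ : ℕ) : (swapOp q m ℓ)ᴴ = swapOp q m ℓ := by
  rw [swapOp_eq_permMatrix, conjTranspose_permMatrix, Equiv.Perm.inv_def,
    Function.Involutive.toPerm_symm]

theorem swapOp_mem_unitaryGroup (ℓ : ℕ) :
    swapOp q m ℓ ∈ unitaryGroup (Block q m × Block q m) ℂ := by
  rw [mem_unitaryGroup_iff, star_eq_conjTranspose, swapOp_eq_permMatrix, conjTranspose_permMatrix,
    ← permMatrix_mul, inv_mul_cancel, permMatrix_one]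

theorem SWAP_regroup (ℓ : ℕ)
    (X : Matrix (Fin k → Block q m × Block q m) (Fin k → Block q m × Block q m) ℂ) :
    SWAP k q m ℓ (regroup k q m X) = regroup k q m (tensorConj k (swapOp q m ℓ) X) := by
  rw [tensorConj_apply, ← tensorPow_conjTranspose, conjTranspose_swapOp, regroup_mul, regroup_mul]
  rfl

theorem regroup_tensorPow_swapOp (ℓ : ℕ) :
    regroup k q m (tensorPow k (swapOp q m ℓ)) =
      (swapLabels_involutive ℓ).toPerm.permMatrix ℂ := by
  rw [← of_ite_eq_permMatrix]
  ext v w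
  simp only [regroup_apply, tensorPow_apply, swapOp, Matrix.of_apply, Finset.prod_ite_zero,
    Finset.mem_univ, true_imp_iff, Finset.prod_const_one]
  refine if_congr ?_ rfl rfl
  simp only [swapFirst, swapLabels, Prod.ext_iff, funext_iff, forall_and]

theorem SWAP_apply (ℓ : ℕ) (X : Op k q m) :
    SWAP k q m ℓ X = X.submatrix (swapLabels ℓ) (swapLabels ℓ) := by
  rw [SWAP, LinearMap.mulLeftRight_apply, regroup_tensorPow_swapOp,
    PEquiv.toMatrix_toPEquiv_mul, PEquiv.mul_toMatrix_toPEquiv, submatrix_submatrix]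
  rfl

theorem SWAP_SWAP (ℓ : ℕ) (X : Op k q m) : SWAP k q m ℓ (SWAP k q m ℓ X) = X := by
  rw [SWAP_apply, SWAP_apply, submatrix_submatrix, (swapLabels_involutive ℓ).comp_self,
    submatrix_id_id]

theorem SWAP_zero (X : Op k q m) : SWAP k q m 0 X = X := SWAP_apply 0 X

theorem inner_SWAP_SWAP (ℓ : ℕ) (X Y : Op k q m) :
    ⟪SWAP k q m ℓ X, SWAP k q m ℓ Y⟫_ℂ = ⟪X, Y⟫_ℂ := by
  rw [SWAP_apply, SWAP_apply]
  exact inner_submatrix_equiv (swapLabels_involutive ℓ).toPerm X Y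

theorem isSymmetric_SWAP (ℓ : ℕ) : (SWAP k q m ℓ).IsSymmetric := fun X Y => by
  rw [← inner_SWAP_SWAP ℓ X, SWAP_SWAP]

theorem SWAP_R (ℓ : ℕ) (X : Op k q m) : SWAP k q m ℓ (R k q m X) = R k q m X := by
  obtain ⟨X, rfl⟩ := (regroup k q m).surjective X
  rw [R_regroup, SWAP_regroup, tensorConj_twirl (swapOp_mem_unitaryGroup ℓ)]

theorem Q_apply (ℓ : ℕ) (X : Op k q m) :
    Q k q m ℓ X = SWAP k q m ℓ (P k q m (SWAP k q m ℓ X)) := rfl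

theorem isSymmetricProjection_Q (ℓ : ℕ) : (Q k q m ℓ).IsSymmetricProjection where
  isIdempotentElem := LinearMap.ext fun X => by
    rw [Module.End.mul_apply, Q_apply, Q_apply, SWAP_SWAP, ← Module.End.mul_apply (P k q m),
      isSymmetricProjection_P.isIdempotentElem.eq]
  isSymmetric X Y := by
    rw [Q_apply, Q_apply, isSymmetric_SWAP, isSymmetricProjection_P.isSymmetric, isSymmetric_SWAP]

theorem range_R_le_range_Q (ℓ : ℕ) :
    LinearMap.range (R k q m) ≤ LinearMap.range (Q k q m ℓ) := by
  rintro _ ⟨X, rfl⟩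
  exact ⟨R k q m X, by rw [Q_apply, SWAP_R, P_R, SWAP_R]⟩

end Swap

section PermPair

variable {k q m : ℕ}

/-- The operator on `A^k B^k` that permutes the copies of `A` by `p.1` and those of `B` by
`p.2`. -/
def permPairOp (p : Equiv.Perm (Fin k) × Equiv.Perm (Fin k)) : Op k q m :=
  permOp p.1 ⊗ₖ permOp p.2

/-- The action of a pair of permutations on basis labels. -/
def permPair (p : Equiv.Perm (Fin k) × Equiv.Perm (Fin k)) (w : Full k q m) : Full k q m :=
  (w.1 ∘ p.1, w.2 ∘ p.2)

theorem permPairOp_apply (p : Equiv.Perm (Fin k) × Equiv.Perm (Fin k)) (v w : Full k q m) :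
    permPairOp p v w = if v = permPair p w then 1 else 0 := by
  rw [permPairOp, kroneckerMap_apply, permOp_apply, permOp_apply, ite_zero_mul_ite_zero, mul_one]
  refine if_congr ?_ rfl rfl
  rw [Prod.ext_iff]
  rfl

theorem range_P_le_span_permPairOp (hk : k ≤ q ^ m) :
    LinearMap.range (P k q m) ≤ Submodule.span ℂ (Set.range permPairOp) := by
  have hcard : k ≤ Fintype.card (Block q m) := by
    rwa [Fintype.card_fun, Fintype.card_fin, Fintype.card_fin]
  rintro _ ⟨X, rfl⟩
  exact superTensor_mem_span (twirl_mem_span_permOp hcard) (twirl_mem_span_permOp hcard) X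

theorem range_Q_le_span_SWAP_permPairOp (ℓ : ℕ) (hk : k ≤ q ^ m) :
    LinearMap.range (Q k q m ℓ) ≤
      Submodule.span ℂ (Set.range fun p => SWAP k q m ℓ (permPairOp p)) := by
  rintro _ ⟨X, rfl⟩
  have h := Submodule.mem_map_of_mem (f := SWAP k q m ℓ)
    (range_P_le_span_permPairOp hk ⟨SWAP k q m ℓ X, rfl⟩)
  rwa [Submodule.map_span, ← Set.range_comp] at h

theorem SWAP_permPairOp_diag_mem_range_R (ℓ : ℕ) (σ : Equiv.Perm (Fin k)) :
    SWAP k q m ℓ (permPairOp (σ, σ)) ∈ LinearMap.range (R k q m) := by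
  have hregroup : permPairOp (σ, σ) = regroup k q m (permOp σ) := by
    ext v w
    rw [regroup_apply, permPairOp_apply, permOp_apply]
    refine if_congr ?_ rfl rfl
    simp only [permPair, Prod.ext_iff, funext_iff, Function.comp_apply, forall_and]
  have hR : R k q m (permPairOp (σ, σ)) = permPairOp (σ, σ) := by
    rw [hregroup, R_regroup,
      twirl_eq_self_of_forall_commute fun U _ => commute_tensorPow_permOp U σ]
  exact ⟨permPairOp (σ, σ), by rw [← SWAP_R ℓ, hR]⟩

end PermPair

section Counting

variable {k q m : ℕ}

/-- The number of colourings of `Fin k` by `c` that two permutations of the positions move to the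
same colouring. -/
def agreeCount (c : Type) [Fintype c] [DecidableEq c] (π σ : Equiv.Perm (Fin k)) : ℕ :=
  Fintype.card {f : Fin k → c // f ∘ π = f ∘ σ}

/-- A colouring counted by `agreeCount` is determined by its restriction to the complement of `π i`
whenever `π i ≠ σ i`. -/
theorem agreeCount_mul_card_le_of_ne (c : Type) [Fintype c] [DecidableEq c]
    {π σ : Equiv.Perm (Fin k)} (h : π ≠ σ) :
    agreeCount c π σ * Fintype.card c ≤ Fintype.card c ^ k := by
  obtain ⟨i, hi⟩ : ∃ i, π i ≠ σ i := by
    by_contra! hne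
    exact h (Equiv.ext hne)
  have hrestore : ∀ u : {f : Fin k → c // f ∘ π = f ∘ σ} × c,
      Function.update (Function.update u.1.1 (π i) u.2) (π i)
        (Function.update u.1.1 (π i) u.2 (σ i)) = u.1.1 := by
    rintro ⟨⟨f, hf⟩, a⟩
    rw [Function.update_idem, Function.update_of_ne hi.symm]
    exact (congrArg _ (congrFun hf i).symm).trans (Function.update_eq_self _ _)
  have hcard := Fintype.card_le_of_injective
    (fun u : {f : Fin k → c // f ∘ π = f ∘ σ} × c => Function.update u.1.1 (π i) u.2)
    fun u v huv => Prod.ext (Subtype.ext (by rw [← hrestore u, ← hrestore v]; simp only [huv]))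
      (by simpa only [Function.update_self] using congrFun huv (π i))
  rwa [Fintype.card_prod, Fintype.card_fun, Fintype.card_fin] at hcard

/-- The number of components in which two pairs of permutations differ. -/
def pairDist (p r : Equiv.Perm (Fin k) × Equiv.Perm (Fin k)) : ℕ :=
  (if p.1 = r.1 then 0 else 1) + if p.2 = r.2 then 0 else 1

theorem one_le_pairDist {p r : Equiv.Perm (Fin k) × Equiv.Perm (Fin k)} (h : p ≠ r) :
    1 ≤ pairDist p r := by
  rw [Ne, Prod.ext_iff, not_and_or] at h
  unfold pairDist
  split_ifs <;> simp_all

/-- In the four-cycle `p.1, r.1, p.2, r.2`, both paths from `p.1` to `p.2` have an edge joining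
distinct permutations. -/
theorem two_le_pairDist_swap_add_pairDist {p : Equiv.Perm (Fin k) × Equiv.Perm (Fin k)}
    (r : Equiv.Perm (Fin k) × Equiv.Perm (Fin k)) (h : p.1 ≠ p.2) :
    2 ≤ pairDist r p.swap + pairDist r p := by
  simp only [pairDist, Prod.fst_swap, Prod.snd_swap]
  grind

theorem agreeCount_mul_agreeCount_mul_pow_le (c : Type) [Fintype c] [DecidableEq c]
    (p r : Equiv.Perm (Fin k) × Equiv.Perm (Fin k)) :
    agreeCount c p.1 r.1 * agreeCount c p.2 r.2 * Fintype.card c ^ pairDist p r ≤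
      Fintype.card c ^ (2 * k) := by
  have hle : ∀ π σ : Equiv.Perm (Fin k),
      agreeCount c π σ * Fintype.card c ^ (if π = σ then 0 else 1) ≤ Fintype.card c ^ k := by
    intro π σ
    split_ifs with h
    · rw [pow_zero, mul_one]
      exact (Fintype.card_subtype_le _).trans_eq (by rw [Fintype.card_fun, Fintype.card_fin])
    · rw [pow_one]
      exact agreeCount_mul_card_le_of_ne c h
  rw [pairDist, pow_add, mul_mul_mul_comm, two_mul, pow_add]
  exact Nat.mul_le_mul (hle _ _) (hle _ _)

/-- The number of basis labels that are moved to the same label by `r` and by the conjugate of `p`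
under `swapLabels ℓ`. -/
def swapCount (q m ℓ : ℕ) (p r : Equiv.Perm (Fin k) × Equiv.Perm (Fin k)) : ℕ :=
  Fintype.card {w : Full k q m // swapLabels ℓ (permPair r w) = permPair p (swapLabels ℓ w)}

theorem inner_SWAP_permPairOp (ℓ : ℕ) (p r : Equiv.Perm (Fin k) × Equiv.Perm (Fin k)) :
    ⟪SWAP k q m ℓ (permPairOp p), permPairOp r⟫_ℂ = swapCount q m ℓ p r := by
  rw [swapCount, Fintype.card_subtype, Finset.card_filter, Nat.cast_sum, inner_eq_trace, trace]
  refine Finset.sum_congr rfl fun w _ => ?_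
  simp only [diag_apply, Matrix.mul_apply, conjTranspose_apply, SWAP_apply, submatrix_apply,
    permPairOp_apply, mul_ite, mul_one, mul_zero, Finset.sum_ite_eq', Finset.mem_univ, if_true,
    apply_ite star, star_one, star_zero, Nat.cast_ite, Nat.cast_one, Nat.cast_zero]

theorem swapCount_zero_self (q m : ℕ) (p : Equiv.Perm (Fin k) × Equiv.Perm (Fin k)) :
    swapCount q m 0 p p = q ^ (2 * (m * k)) := by
  rw [swapCount, Fintype.card_congr (Equiv.subtypeUnivEquiv fun w => by rfl)]
  simp only [Fintype.card_prod, Fintype.card_fun, Fintype.card_fin, ← pow_mul, ← pow_add, two_mul]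

/-- The pair of permutations by which the conjugate of `p` under `SWAP ℓ` acts on the `j`-th
qudits. -/
def swapAt (ℓ : ℕ) {m : ℕ} (j : Fin m) (p : Equiv.Perm (Fin k) × Equiv.Perm (Fin k)) :
    Equiv.Perm (Fin k) × Equiv.Perm (Fin k) :=
  if j.val < ℓ then p.swap else p

theorem swapLabels_permPair_eq_iff (ℓ : ℕ) (p r : Equiv.Perm (Fin k) × Equiv.Perm (Fin k))
    (w : Full k q m) : swapLabels ℓ (permPair r w) = permPair p (swapLabels ℓ w) ↔
      ∀ j, (fun i => w.1 i j) ∘ r.1 = (fun i => w.1 i j) ∘ (swapAt ℓ j p).1 ∧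
        (fun i => w.2 i j) ∘ r.2 = (fun i => w.2 i j) ∘ (swapAt ℓ j p).2 := by
  have hcol : swapLabels ℓ (permPair r w) = permPair p (swapLabels ℓ w) ↔ ∀ j,
      (∀ i, (swapLabels ℓ (permPair r w)).1 i j = (permPair p (swapLabels ℓ w)).1 i j) ∧
      ∀ i, (swapLabels ℓ (permPair r w)).2 i j = (permPair p (swapLabels ℓ w)).2 i j := by
    simp only [Prod.ext_iff, funext_iff, forall_and]
    exact and_congr forall_comm forall_comm
  rw [hcol]
  refine forall_congr' fun j => ?_
  simp only [swapLabels, permPair, swapAt, funext_iff, Function.comp_apply]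
  split_ifs
  exacts [and_comm, Iff.rfl]

theorem swapCount_eq_prod (q m ℓ : ℕ) (p r : Equiv.Perm (Fin k) × Equiv.Perm (Fin k)) :
    swapCount q m ℓ p r = ∏ j : Fin m,
      agreeCount (Fin q) r.1 (swapAt ℓ j p).1 * agreeCount (Fin q) r.2 (swapAt ℓ j p).2 := by
  let columns : Full k q m ≃ (Fin m → (Fin k → Fin q) × (Fin k → Fin q)) :=
    { toFun w j := (fun i => w.1 i j, fun i => w.2 i j)
      invFun u := (fun i j => (u j).1 i, fun i j => (u j).2 i)
      left_inv _ := rfl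
      right_inv _ := rfl }
  let Agree (j : Fin m) (u : (Fin k → Fin q) × (Fin k → Fin q)) : Prop :=
    u.1 ∘ r.1 = u.1 ∘ (swapAt ℓ j p).1 ∧ u.2 ∘ r.2 = u.2 ∘ (swapAt ℓ j p).2
  calc swapCount q m ℓ p r = Fintype.card (∀ j, {u // Agree j u}) :=
        Fintype.card_congr ((columns.subtypeEquiv (q := fun u => ∀ j, Agree j (u j))
          (swapLabels_permPair_eq_iff ℓ p r)).trans Equiv.subtypePiEquivPi)
    _ = ∏ j, Fintype.card {u // Agree j u} := Fintype.card_pi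
    _ = _ := Finset.prod_congr rfl fun j _ =>
        (Fintype.card_congr (Equiv.subtypeProdEquivProd
          (p := fun f : Fin k → Fin q => f ∘ r.1 = f ∘ (swapAt ℓ j p).1)
          (q := fun f : Fin k → Fin q => f ∘ r.2 = f ∘ (swapAt ℓ j p).2))).trans
          (Fintype.card_prod _ _)

theorem sum_pairDist_swapAt {ℓ : ℕ} (hℓ : ℓ ≤ m)
    (p r : Equiv.Perm (Fin k) × Equiv.Perm (Fin k)) :
    ∑ j : Fin m, pairDist r (swapAt ℓ j p) =
      ℓ * pairDist r p.swap + (m - ℓ) * pairDist r p := by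
  obtain ⟨d, rfl⟩ := Nat.exists_eq_add_of_le hℓ
  rw [Fin.sum_univ_add]
  simp [swapAt]

theorem swapCount_mul_pow_le {ℓ e : ℕ} (hq : 1 ≤ q) (hℓ : ℓ ≤ m)
    {p r : Equiv.Perm (Fin k) × Equiv.Perm (Fin k)}
    (he : e ≤ ℓ * pairDist r p.swap + (m - ℓ) * pairDist r p) :
    swapCount q m ℓ p r * q ^ e ≤ q ^ (2 * (m * k)) := by
  calc swapCount q m ℓ p r * q ^ e
      ≤ swapCount q m ℓ p r * q ^ ∑ j : Fin m, pairDist r (swapAt ℓ j p) :=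
        Nat.mul_le_mul_left _
          (Nat.pow_le_pow_right hq (he.trans_eq (sum_pairDist_swapAt hℓ p r).symm))
    _ = ∏ j : Fin m, agreeCount (Fin q) r.1 (swapAt ℓ j p).1 *
          agreeCount (Fin q) r.2 (swapAt ℓ j p).2 * q ^ pairDist r (swapAt ℓ j p) := by
        rw [swapCount_eq_prod, ← Finset.prod_pow_eq_pow_sum, ← Finset.prod_mul_distrib]
    _ ≤ ∏ _j : Fin m, q ^ (2 * k) := Finset.prod_le_prod' fun j _ => by
        simpa only [Fintype.card_fin] using
          agreeCount_mul_agreeCount_mul_pow_le (Fin q) r (swapAt ℓ j p)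
    _ = q ^ (2 * (m * k)) := by
        rw [Finset.prod_const, Finset.card_univ, Fintype.card_fin, ← pow_mul]
        ring_nf

theorem norm_inner_SWAP_permPairOp_le {ℓ e : ℕ} (hq : 1 ≤ q) (hℓ : ℓ ≤ m)
    {p r : Equiv.Perm (Fin k) × Equiv.Perm (Fin k)}
    (he : e ≤ ℓ * pairDist r p.swap + (m - ℓ) * pairDist r p) :
    ‖⟪SWAP k q m ℓ (permPairOp p), permPairOp r⟫_ℂ‖ ≤ (q : ℝ) ^ (2 * (m * k)) / q ^ e := by
  rw [inner_SWAP_permPairOp, Complex.norm_natCast, le_div_iff₀ (by positivity)]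
  exact_mod_cast swapCount_mul_pow_le hq hℓ he

variable {ℓ : ℕ}

theorem isAlmostOrthogonal_permPairOp (hq : 1 ≤ q) (hℓ : 2 * ℓ ≤ m) :
    IsAlmostOrthogonal ℂ ((q : ℝ) ^ (2 * (m * k))) ((q : ℝ) ^ (2 * (m * k)) / q ^ (2 * ℓ))
      (permPairOp : _ → Op k q m) where
  nonneg_diag := by positivity
  nonneg_offDiag := by positivity
  inner_self p := by
    have h := inner_SWAP_permPairOp (q := q) (m := m) 0 p p
    rw [SWAP_zero, swapCount_zero_self] at h
    exact_mod_cast h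
  norm_inner_le p r hpr := by
    have hdist : 2 * ℓ ≤ 0 * pairDist r p.swap + (m - 0) * pairDist r p := by
      rw [zero_mul, zero_add, Nat.sub_zero]
      exact hℓ.trans (Nat.le_mul_of_pos_right m (one_le_pairDist hpr.symm))
    simpa only [SWAP_zero] using norm_inner_SWAP_permPairOp_le hq m.zero_le hdist

theorem isAlmostOrthogonal_SWAP_permPairOp (hq : 1 ≤ q) (hℓ : 2 * ℓ ≤ m) :
    IsAlmostOrthogonal ℂ ((q : ℝ) ^ (2 * (m * k))) ((q : ℝ) ^ (2 * (m * k)) / q ^ (2 * ℓ))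
      fun p => SWAP k q m ℓ (permPairOp p) where
  nonneg_diag := by positivity
  nonneg_offDiag := by positivity
  inner_self p := by rw [inner_SWAP_SWAP, (isAlmostOrthogonal_permPairOp hq hℓ).inner_self]
  norm_inner_le p r hpr := by
    rw [inner_SWAP_SWAP]
    exact (isAlmostOrthogonal_permPairOp hq hℓ).norm_inner_le p r hpr

theorem SWAP_permPairOp_mem_range_R_or_norm_inner_le (hq : 1 ≤ q) (hℓ : 2 * ℓ ≤ m)
    (p : Equiv.Perm (Fin k) × Equiv.Perm (Fin k)) :
    SWAP k q m ℓ (permPairOp p) ∈ LinearMap.range (R k q m) ∨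
      ∀ r, ‖⟪SWAP k q m ℓ (permPairOp p), permPairOp r⟫_ℂ‖ ≤
        (q : ℝ) ^ (2 * (m * k)) / q ^ (2 * ℓ) := by
  obtain ⟨π, σ⟩ := p
  rcases eq_or_ne π σ with rfl | hne
  · exact .inl (SWAP_permPairOp_diag_mem_range_R ℓ π)
  · refine .inr fun r => norm_inner_SWAP_permPairOp_le hq (by omega) ?_
    have hdist := two_le_pairDist_swap_add_pairDist r (p := (π, σ)) hne
    have hℓm : ℓ ≤ m - ℓ := by omega
    nlinarith [Nat.mul_le_mul_right (pairDist r (π, σ)) hℓm]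

end Counting

section SubspaceAngle

variable {k q m : ℕ}

theorem subspaceAngle_le {ℓ : ℕ} {c : ℝ} (hc : 0 ≤ c)
    (h : ∀ X : Op k q m, ‖(Q k q m ℓ ∘ₗ P k q m - R k q m) X‖ ≤ c * ‖X‖) :
    subspaceAngle k q m ℓ ≤ c := by
  refine Real.sSup_le ?_ hc
  rintro _ ⟨X, hX, rfl⟩
  exact (div_le_iff₀ (norm_pos_iff.2 hX)).2 (h X)

theorem subspaceAngle_le_one (k q m ℓ : ℕ) : subspaceAngle k q m ℓ ≤ 1 :=
  subspaceAngle_le zero_le_one fun X => (norm_comp_sub_apply_le isSymmetricProjection_P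
    (isSymmetricProjection_Q ℓ) isSymmetricProjection_R range_R_le_range_P
    (range_R_le_range_Q ℓ) X).trans_eq (one_mul _).symm

theorem subspaceAngle_le_of_le_pow {ℓ : ℕ} (hq : 1 ≤ q) (hℓ : 2 * ℓ ≤ m) (hk : k ≤ q ^ m) :
    subspaceAngle k q m ℓ ≤ 2 * (k.factorial : ℝ) ^ 2 / (q : ℝ) ^ (2 * ℓ) := by
  refine subspaceAngle_le (by positivity) fun X => ?_
  have hs : (0 : ℝ) < (q : ℝ) ^ (2 * (m * k)) := by positivity
  have hcard : Fintype.card (Equiv.Perm (Fin k) × Equiv.Perm (Fin k)) = k.factorial ^ 2 := by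
    rw [Fintype.card_prod, Fintype.card_perm, Fintype.card_fin, sq]
  have h := norm_comp_sub_apply_le_of_isAlmostOrthogonal isSymmetricProjection_P
    (isSymmetricProjection_Q ℓ) isSymmetricProjection_R range_R_le_range_P (range_R_le_range_Q ℓ)
    (isAlmostOrthogonal_permPairOp hq hℓ) (isAlmostOrthogonal_SWAP_permPairOp hq hℓ)
    (range_P_le_span_permPairOp hk) (range_Q_le_span_SWAP_permPairOp ℓ hk)
    (SWAP_permPairOp_mem_range_R_or_norm_inner_le hq hℓ) X
  rw [hcard] at h
  refine le_of_mul_le_mul_left (h.trans_eq ?_) hs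
  push_cast
  ring

end SubspaceAngle

section Bound

theorem pow_eight_le_factorial_pow_three (k : ℕ) : k ^ 8 ≤ 64 * k.factorial ^ 3 := by
  rcases lt_or_ge k 4 with hk | hk
  · interval_cases k <;> decide
  induction k, hk using Nat.le_induction with
  | base => decide
  | succ n hn ih =>
    have hstep : (n + 1) ^ 5 ≤ n ^ 8 :=
      calc (n + 1) ^ 5 ≤ (2 * n) ^ 5 := Nat.pow_le_pow_left (by omega) 5
        _ = 32 * n ^ 5 := by ring
        _ ≤ n ^ 3 * n ^ 5 :=
          Nat.mul_le_mul_right _ ((by decide : 32 ≤ 4 ^ 3).trans (Nat.pow_le_pow_left hn 3))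
        _ = n ^ 8 := by ring
    calc (n + 1) ^ 8 = (n + 1) ^ 3 * (n + 1) ^ 5 := by ring
      _ ≤ (n + 1) ^ 3 * (64 * n.factorial ^ 3) := Nat.mul_le_mul_left _ (hstep.trans ih)
      _ = 64 * (n + 1).factorial ^ 3 := by rw [Nat.factorial_succ]; ring

/-- When `k ^ 2 > 2 * d` the constant `a ^ 2 = (1 - x)⁻⁴` may be small, but `(k !) ^ 3 / d` then
outweighs it. -/
theorem one_le_factorial_pow_three_div {k : ℕ} {d : ℝ} (hd : 1 ≤ d)
    (hx : 1 < (k : ℝ) ^ 2 / (2 * d)) :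
    1 ≤ 4 * (((1 - (k : ℝ) ^ 2 / (2 * d)) ^ 2)⁻¹) ^ 2 * (k.factorial : ℝ) ^ 3 / d := by
  set x := (k : ℝ) ^ 2 / (2 * d) with hxdef
  have hk : (k : ℝ) ^ 8 ≤ 64 * (k.factorial : ℝ) ^ 3 := by
    exact_mod_cast pow_eight_le_factorial_pow_three k
  have hpos : 0 < (x - 1) ^ 4 * d := mul_pos (pow_pos (sub_pos.2 hx) 4) (by positivity)
  have hnum : (x - 1) ^ 4 * d ≤ 4 * (k.factorial : ℝ) ^ 3 :=
    calc (x - 1) ^ 4 * d ≤ x ^ 4 * d := by gcongr; linarith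
      _ = (k : ℝ) ^ 8 / (16 * d ^ 3) := by rw [hxdef]; field_simp; ring
      _ ≤ (k : ℝ) ^ 8 / 16 := by
        gcongr
        exact le_mul_of_one_le_right (by norm_num) (one_le_pow₀ hd)
      _ ≤ 4 * (k.factorial : ℝ) ^ 3 := by linarith
  calc (1 : ℝ) ≤ 4 * (k.factorial : ℝ) ^ 3 / ((x - 1) ^ 4 * d) := (one_le_div hpos).2 hnum
    _ = 4 * (((1 - x) ^ 2)⁻¹) ^ 2 * (k.factorial : ℝ) ^ 3 / d := by
      rw [← neg_sub x 1, neg_sq, ← inv_pow, ← pow_mul, div_mul_eq_div_div, inv_pow,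
        div_eq_mul_inv (_ * _)]
      ring

theorem sq_min_one_factorial_sq_div_le {k : ℕ} {d D a : ℝ} (hD : 1 ≤ D) (hDd : D ≤ d)
    (hkd : (k : ℝ) ^ 2 ≠ 2 * d) (ha : a = ((1 - (k : ℝ) ^ 2 / (2 * d)) ^ 2)⁻¹) :
    min 1 (2 * (k.factorial : ℝ) ^ 2 / D) ^ 2 ≤ 4 * a ^ 2 * (k.factorial : ℝ) ^ 3 / D := by
  have hd : 0 < d := by linarith
  have hN : (1 : ℝ) ≤ k.factorial := by exact_mod_cast k.factorial_pos
  set u := 2 * (k.factorial : ℝ) ^ 2 / D with hu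
  have hmin : 0 ≤ min 1 u := le_min zero_le_one (by positivity)
  rcases lt_or_ge 1 ((k : ℝ) ^ 2 / (2 * d)) with hx | hx
  · calc min 1 u ^ 2 ≤ 1 := pow_le_one₀ hmin (min_le_left _ _)
      _ ≤ 4 * a ^ 2 * (k.factorial : ℝ) ^ 3 / d := by
        rw [ha]
        exact one_le_factorial_pow_three_div (hD.trans hDd) hx
      _ ≤ 4 * a ^ 2 * (k.factorial : ℝ) ^ 3 / D := by gcongr
  · have hx1 : (k : ℝ) ^ 2 / (2 * d) < 1 :=
      hx.lt_of_ne fun h => hkd ((div_eq_one_iff_eq (by positivity)).1 h)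
    have hx0 : 0 ≤ (k : ℝ) ^ 2 / (2 * d) := by positivity
    have ha1 : 1 ≤ a := by
      rw [ha]
      exact (one_le_inv₀ (pow_pos (by linarith) 2)).2 (pow_le_one₀ (by linarith) (by linarith))
    calc min 1 u ^ 2 ≤ 1 * u := by
          rw [sq]
          exact mul_le_mul (min_le_left _ _) (min_le_right _ _) hmin zero_le_one
      _ ≤ 4 * a ^ 2 * (k.factorial : ℝ) ^ 3 / D := by
        rw [one_mul, hu]
        gcongr
        · nlinarith [one_le_pow₀ ha1 (n := 2)]
        · norm_num

theorem min_one_factorial_sq_div_le_sqrt {k q m ℓ : ℕ} (hq : 1 ≤ q) (hℓ : 2 * ℓ ≤ m)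
    (hk2 : k ^ 2 ≠ 2 * q ^ m) {a : ℝ} (ha : a = (1 - (k : ℝ) ^ 2 / (2 * (q : ℝ) ^ m)) ^ (-2 : ℤ)) :
    min 1 (2 * (k.factorial : ℝ) ^ 2 / (q : ℝ) ^ (2 * ℓ)) ≤
      √(9 * a * (k : ℝ) ^ 2 * (q : ℝ) ^ (-(m : ℤ)) +
        4 * a ^ 2 * (k.factorial : ℝ) ^ 3 * (q : ℝ) ^ (-(2 * ℓ : ℤ)) +
        2 * a ^ 2 * (k.factorial : ℝ) ^ 5 * (q : ℝ) ^ (-(4 * ℓ : ℤ))) := by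
  have hq1 : (1 : ℝ) ≤ q := by exact_mod_cast hq
  have ha' : a = ((1 - (k : ℝ) ^ 2 / (2 * (q : ℝ) ^ m)) ^ 2)⁻¹ := by
    rw [ha, _root_.zpow_neg]
    norm_cast
  have hpow : (q : ℝ) ^ (-(2 * ℓ : ℤ)) = ((q : ℝ) ^ (2 * ℓ))⁻¹ := by
    rw [_root_.zpow_neg]
    norm_cast
  have hmiddle := sq_min_one_factorial_sq_div_le (one_le_pow₀ hq1 (n := 2 * ℓ))
    (pow_le_pow_right₀ hq1 hℓ) (by exact_mod_cast hk2) ha'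
  rw [div_eq_mul_inv (4 * a ^ 2 * _), ← hpow] at hmiddle
  have ha0 : 0 ≤ a := by rw [ha']; positivity
  have hfirst : 0 ≤ 9 * a * (k : ℝ) ^ 2 * (q : ℝ) ^ (-(m : ℤ)) := by positivity
  have hlast : 0 ≤ 2 * a ^ 2 * (k.factorial : ℝ) ^ 5 * (q : ℝ) ^ (-(4 * ℓ : ℤ)) := by positivity
  exact Real.le_sqrt_of_sq_le (by linarith)

end Bound

end TwirlSwap

end

theorem mainTheorem6_general (k q m ℓ : ℕ) (hq : 1 ≤ q) (hℓ : 2 * ℓ ≤ m) :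
    TwirlSwap.subspaceAngle k q m ℓ ≤
      min 1 (2 * (k.factorial : ℝ) ^ 2 / (q : ℝ) ^ (2 * ℓ)) := by
  refine le_min (TwirlSwap.subspaceAngle_le_one k q m ℓ) ?_
  by_cases hk : k ≤ q ^ m
  · exact TwirlSwap.subspaceAngle_le_of_le_pow hq hℓ hk
  · refine (TwirlSwap.subspaceAngle_le_one k q m ℓ).trans ((one_le_div (by positivity)).2 ?_)
    have hpow : q ^ (2 * ℓ) ≤ 2 * k.factorial ^ 2 :=
      calc q ^ (2 * ℓ) ≤ q ^ m := Nat.pow_le_pow_right hq hℓ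
        _ ≤ k := (not_le.1 hk).le
        _ ≤ k.factorial := k.self_le_factorial
        _ ≤ 2 * k.factorial ^ 2 := by nlinarith [k.factorial_pos]
    exact_mod_cast hpow

theorem mainTheorem6 (k q m ℓ : ℕ) (hq : 1 ≤ q) (hℓ : 2 * ℓ ≤ m) (hk : k ≤ q ^ m)
    (hk2 : k ^ 2 ≠ 2 * q ^ m) (a : ℝ)
    (ha : a = (1 - (k : ℝ) ^ 2 / (2 * (q : ℝ) ^ m)) ^ (-2 : ℤ)) :
    TwirlSwap.subspaceAngle k q m ℓ ≤
      Real.sqrt (9 * a * (k : ℝ) ^ 2 * (q : ℝ) ^ (-(m : ℤ)) +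
        4 * a ^ 2 * (k.factorial : ℝ) ^ 3 * (q : ℝ) ^ (-(2 * ℓ : ℤ)) +
        2 * a ^ 2 * (k.factorial : ℝ) ^ 5 * (q : ℝ) ^ (-(4 * ℓ : ℤ))) :=
  (mainTheorem6_general k q m ℓ hq hℓ).trans
    (TwirlSwap.min_one_factorial_sq_div_le_sqrt hq hℓ hk2 ha)
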